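/- Let $n\in\mathbb N$, $m>0$, $r_0>0$, $0\le k<m/4$, let $k_{\mathrm C}\in L^\infty([-r_0,r_0])$ be real-valued, and put $k(t)=k_{\mathrm C}(t)$ for $|t|\le r_0$, $k(t)=k\,t^{-2}$ for $|t|>r_0$. Let $\lambda=\tfrac12\bigl(1-\sqrt{1-4k/m}\bigr)\in[0,1/2)$ be the smaller root of $\lambda(\lambda-1)+k/m=0$. On $L^2(\mathbb R^n)$ let $x$ be the position, $p=-i\nabla$ the momentum, $A=x\cdot p+p\cdot x$, and let $e^{-i\beta A}$ $(\beta\in\mathbb R)$ be the strongly continuous unitary group generated by $A$. Let $V:\mathbb R\times\mathbb R^n\to\mathbb R$ be continuous and bounded on $[-T,T]\times\mathbb R^n$ for every $T>0$, and set $$H_0(t)=\frac{p^2}{2m}+\frac{k(t)}2x^2,\quad H(t)=H_0(t)+V(t,x),\quad H_{0,S}(t)=\frac{p^2}{2m|t|^{2\lambda}},\quad H_S(t)=H_{0,S}(t)+V(t,|t|^\lambda x).$$ A propagator for a time-dependent Hamiltonian $K(t)$ on a time interval $I$ is a jointly strongly continuous family of unitary operators $\{U(t,s)\}_{t,s\in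 I}$ with $U(s,s)=\mathrm{Id}$, $U(t,\theta)U(\theta,s)=U(t,s)$, $i\partial_tU(t,s)=K(t)U(t,s)$ and $i\partial_sU(t,s)=-U(t,s)K(s)$, where the two equations are understood in integrated form on Schwartz functions: for all Schwartz $\varphi$, all $\psi\in L^2$ and all $s,t\in I$, $$i\bigl(\langle\varphi,U(t,s)\psi\rangle-\langle\varphi,\psi\rangle\bigr)=\int_s^t\langle K(\tau)\varphi,U(\tau,s)\psi\rangle\,d\tau,\qquad i\bigl(U(t,s)\varphi-\varphi\bigr)=-\int_t^sU(t,\tau)K(\tau)\varphi\,d\tau .$$ Let $U_0$ and $U$ be propagators for $H_0$ and $H$ on $\mathbb R$, and, for either choice of the sign $\pm$, let $U_{0,S}$ and $U_S$ be propagators for $H_{0,S}$ and $H_S$ on $\{t:\pm t\ge r_0\}$. Put $$J(t)=e^{im\lambda x^2/(2t)}\,e^{-i\lambda(\log|t|)A/2}\qquad(t\ne0).$$ Then for all $t$ with $\pm t\ge r_0$, $$U_0(t,\pm r_0)=J(t)\,U_{0,S}(t,\pm r_0)\,J(\pm r_0)^{-1}\qquad\text{and}\qquad U(t,\pm r_0)=J(t)\,U_S(t,\pm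 r_0)\,J(\pm r_0)^{-1}.$$ -/

import Mathlib

open MeasureTheory SchwartzMap
open scoped LineDeriv ENNReal

noncomputable section

namespace TimeDecayingOscillator

/-- The configuration space `ℝⁿ` with its Euclidean norm. -/
abbrev Space (n : ℕ) := EuclideanSpace ℝ (Fin n)

/-- The Hilbert space `L²(ℝⁿ; ℂ)`. -/
abbrev L2 (n : ℕ) := Lp ℂ 2 (volume : Measure (Space n))

/-- The group of unitary operators on `L²(ℝⁿ)`; the product is composition. -/
abbrev Unitary (n : ℕ) := L2 n ≃ₗᵢ[ℂ] L2 n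

/-- The position operator `x_j` on Schwartz functions: `(x_j φ)(x) = x_j φ(x)`. -/
def posOp {n : ℕ} (j : Fin n) (φ : 𝓢(Space n, ℂ)) : 𝓢(Space n, ℂ) :=
  smulLeftCLM ℂ (fun x : Space n => ((x j : ℝ) : ℂ)) φ

/-- The momentum operator `p_j = -i ∂_j` on Schwartz functions. -/
def momOp {n : ℕ} (j : Fin n) (φ : 𝓢(Space n, ℂ)) : 𝓢(Space n, ℂ) :=
  (-Complex.I) • ∂_{EuclideanSpace.single j (1 : ℝ)} φ

theorem posOp_apply {n : ℕ} (j : Fin n) (φ : 𝓢(Space n, ℂ)) (x : Space n) :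
    posOp j φ x = ((x j : ℝ) : ℂ) * φ x := by
  have h : (fun x : Space n => ((x j : ℝ) : ℂ)).HasTemperateGrowth :=
    (Complex.ofRealCLM.comp (EuclideanSpace.proj (𝕜 := ℝ) j)).hasTemperateGrowth
  simp [posOp, smulLeftCLM_apply_apply h]

theorem momOp_apply {n : ℕ} (j : Fin n) (φ : 𝓢(Space n, ℂ)) (x : Space n) :
    momOp j φ x = -Complex.I * fderiv ℝ φ x (EuclideanSpace.single j (1 : ℝ)) := by
  rfl

/-- `x² = ∑ x_j x_j` on Schwartz functions. -/
def posSq {n : ℕ} (φ : 𝓢(Space n, ℂ)) : 𝓢(Space n, ℂ) := ∑ j, posOp j (posOp j φ)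

/-- `p² = ∑ p_j p_j` on Schwartz functions. -/
def momSq {n : ℕ} (φ : 𝓢(Space n, ℂ)) : 𝓢(Space n, ℂ) := ∑ j, momOp j (momOp j φ)

/-- `A = x · p + p · x` on Schwartz functions. -/
def dilationGen {n : ℕ} (φ : 𝓢(Space n, ℂ)) : 𝓢(Space n, ℂ) :=
  ∑ j, (posOp j (momOp j φ) + momOp j (posOp j φ))

open Classical in
/-- The multiplication operator by a real function `v` on `L²(ℝⁿ)`, with its natural domain
`{f | v f ∈ L²}` (extended by the junk value `0` off that domain). -/
def mulOp {n : ℕ} (v : Space n → ℝ) (f : L2 n) : L2 n :=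
  if h : MemLp (fun x => (v x : ℂ) * f x) 2 (volume : Measure (Space n)) then h.toLp else 0

/-- `p²/(2m) + (k(t)/2) x²`, on Schwartz functions. -/
def freeHam {n : ℕ} (m : ℝ) (k : ℝ → ℝ) (t : ℝ) (φ : 𝓢(Space n, ℂ)) : L2 n :=
  ((((1 / (2 * m) : ℝ) : ℂ) • momSq φ + ((k t / 2 : ℝ) : ℂ) • posSq φ).toLp 2 volume)

/-- `p²/(2m) + (k(t)/2) x² + V(t,x)`, on Schwartz functions. -/
def ham {n : ℕ} (m : ℝ) (k : ℝ → ℝ) (V : ℝ → Space n → ℝ) (t : ℝ) (φ : 𝓢(Space n, ℂ)) : L2 n :=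
  freeHam m k t φ + mulOp (V t) (φ.toLp 2 volume)

/-- `p²/(2m|t|^{2λ})`, on Schwartz functions. -/
def reducedFreeHam {n : ℕ} (m lam : ℝ) (t : ℝ) (φ : 𝓢(Space n, ℂ)) : L2 n :=
  (((1 / (2 * m * |t| ^ (2 * lam)) : ℝ) : ℂ) • momSq φ).toLp 2 volume

/-- `p²/(2m|t|^{2λ}) + V(t,|t|^λ x)`, on Schwartz functions. -/
def reducedHam {n : ℕ} (m lam : ℝ) (V : ℝ → Space n → ℝ) (t : ℝ) (φ : 𝓢(Space n, ℂ)) : L2 n :=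
  reducedFreeHam m lam t φ + mulOp (fun x => V t ((|t| ^ lam) • x)) (φ.toLp 2 volume)

/-- `U` is a (strongly continuous, unitary) propagator, on the time interval `I`, for the
time-dependent Hamiltonian `H(t)`, which is given on Schwartz functions.  The two evolution equations
`i ∂_t U(t,s) = H(t) U(t,s)` and `i ∂_s U(t,s) = -U(t,s) H(s)` are required in integrated form on
the core of Schwartz functions, the first one weakly (since `U(t,s)ψ` need not be in the domain of
`H(t)`, and `H` need not be continuous in `t`). -/
structure IsPropagatorOn {n : ℕ} (I : Set ℝ) (H : ℝ → 𝓢(Space n, ℂ) → L2 n)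
    (U : ℝ → ℝ → Unitary n) : Prop where
  self : ∀ s ∈ I, U s s = 1
  comp : ∀ t ∈ I, ∀ θ ∈ I, ∀ s ∈ I, U t θ * U θ s = U t s
  continuousOn : ∀ ψ : L2 n, ContinuousOn (fun z : ℝ × ℝ => U z.1 z.2 ψ) (I ×ˢ I)
  forward : ∀ t ∈ I, ∀ s ∈ I, ∀ (φ : 𝓢(Space n, ℂ)) (ψ : L2 n),
    IntervalIntegrable (fun τ => inner ℂ (H τ φ) (U τ s ψ)) volume s t ∧
    Complex.I * (inner ℂ (φ.toLp 2 volume) (U t s ψ) - inner ℂ (φ.toLp 2 volume) ψ) =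
      ∫ τ in s..t, inner ℂ (H τ φ) (U τ s ψ)
  backward : ∀ t ∈ I, ∀ s ∈ I, ∀ φ : 𝓢(Space n, ℂ),
    IntervalIntegrable (fun τ => U t τ (H τ φ)) volume t s ∧
    Complex.I • (U t s (φ.toLp 2 volume) - φ.toLp 2 volume) = -∫ τ in t..s, U t τ (H τ φ)

/-- `W` is the strongly continuous one-parameter unitary group `β ↦ e^{-iβB}`, for an operator `B`
that is essentially self-adjoint on Schwartz functions: by Stone's theorem this says that the
self-adjoint generator of `W` extends `B`. -/
structure IsUnitaryGroup {n : ℕ} (B : 𝓢(Space n, ℂ) → 𝓢(Space n, ℂ)) (W : ℝ → Unitary n) :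
    Prop where
  zero : W 0 = 1
  add : ∀ a b, W (a + b) = W a * W b
  continuous : ∀ ψ : L2 n, Continuous fun β => W β ψ
  generator : ∀ φ : 𝓢(Space n, ℂ),
    HasDerivAt (fun β => W β (φ.toLp 2 volume)) ((-Complex.I) • (B φ).toLp 2 volume) 0

/-- The unitary group `β ↦ e^{-iβA}` generated by `A = x · p + p · x`. -/
def expA (n : ℕ) : ℝ → Unitary n :=
  Classical.epsilon (IsUnitaryGroup (n := n) dilationGen)

theorem phase_memLp {n : ℕ} (c : ℝ) (f : L2 n) :
    MemLp (fun x => Complex.exp (Complex.I * ((c * ‖x‖ ^ 2 : ℝ) : ℂ)) * f x) 2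
      (volume : Measure (Space n)) := by
  refine (Lp.memLp f).of_le ?_ ?_
  · exact (Continuous.aestronglyMeasurable (by fun_prop)).mul (Lp.aestronglyMeasurable f)
  · refine Filter.Eventually.of_forall fun x => ?_
    rw [norm_mul, mul_comm Complex.I, Complex.norm_exp_ofReal_mul_I, one_mul]

theorem phase_inv {n : ℕ} (c : ℝ) (f : L2 n) :
    (phase_memLp (-c) ((phase_memLp c f).toLp)).toLp = f := by
  apply Lp.ext
  filter_upwards [(phase_memLp (-c) ((phase_memLp c f).toLp)).coeFn_toLp,
    (phase_memLp c f).coeFn_toLp] with x h1 h2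
  rw [h1, h2, ← mul_assoc, ← Complex.exp_add]
  simp

/-- The unitary operator `e^{i c x²}` of multiplication by `exp(i c |x|²)` on `L²(ℝⁿ)`. -/
def phase {n : ℕ} (c : ℝ) : Unitary n where
  toFun f := (phase_memLp c f).toLp
  invFun f := (phase_memLp (-c) f).toLp
  left_inv f := phase_inv c f
  right_inv f := by simpa using phase_inv (-c) f
  map_add' f g := by
    apply Lp.ext
    filter_upwards [(phase_memLp c (f + g)).coeFn_toLp, (phase_memLp c f).coeFn_toLp,
      (phase_memLp c g).coeFn_toLp, Lp.coeFn_add f g,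
      Lp.coeFn_add ((phase_memLp c f).toLp) ((phase_memLp c g).toLp)] with x h1 h2 h3 h4 h5
    rw [h1, h5, Pi.add_apply, h2, h3, h4, Pi.add_apply, mul_add]
  map_smul' a f := by
    apply Lp.ext
    filter_upwards [(phase_memLp c (a • f)).coeFn_toLp, (phase_memLp c f).coeFn_toLp,
      Lp.coeFn_smul a f, Lp.coeFn_smul a ((phase_memLp c f).toLp)] with x h1 h2 h3 h4
    simp only [RingHom.id_apply]
    rw [h1, h4, Pi.smul_apply, h2, h3, Pi.smul_apply, smul_eq_mul, smul_eq_mul]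
    ring
  norm_map' f := by
    change ‖(phase_memLp c f).toLp‖ = ‖f‖
    rw [Lp.norm_toLp, Lp.norm_def]
    congr 1
    refine eLpNorm_congr_norm_ae (Filter.Eventually.of_forall fun x => ?_)
    rw [norm_mul, mul_comm Complex.I, Complex.norm_exp_ofReal_mul_I, one_mul]

/-- The coefficient of the harmonic potential: `k_C(t)` for `|t| ≤ r₀` and `k t⁻²` for
`|t| > r₀`. -/
def coeff (r₀ k : ℝ) (kC : ℝ → ℝ) (t : ℝ) : ℝ := if |t| ≤ r₀ then kC t else k / t ^ 2

/-- The smaller root of `λ (λ - 1) + k / m = 0`. -/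
def lam (m k : ℝ) : ℝ := (1 - Real.sqrt (1 - 4 * k / m)) / 2

end TimeDecayingOscillator

end

namespace TimeDecayingOscillator

open Filter Topology

/-! ### Strongly continuous unitary groups with a generator on Schwartz functions -/

/-! Let $c$ be a primitive of $1/(2m|t|^{2\lambda})$. The free reduced evolution of a Schwartz
function is $e^{-ic(t)p^2}\varphi$, and $T(t)=J(t)e^{-ic(t)p^2}\varphi$ solves
$i\partial_tT=H_0(t)T$ for $|t|>r_0$ (`hasDerivAt_oscillator`). Indeed the dilation turns the
coefficient $|t|^{-2\lambda}$ of $p^2$ into $1$. The phase replaces $p$ by $p+(m\lambda/t)x$, and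
the resulting multiple of $A$ is the one produced by differentiating the dilation. The remaining
$x^2$ terms add up to $k/(2t^2)$ exactly because $\lambda(\lambda-1)+k/m=0$.

The vectors $U(t,s)\psi$ need not lie in the domain of $H(t)$, so $J(t)^{-1}U(t,s)$ cannot be
differentiated directly. Instead the explicit solutions, which are Schwartz functions at every time,
serve as moving test vectors in the weak equation. Pairing $U\psi'$ with $T$ and $U_S\psi$ with
$e^{-icp^2}\varphi$ cancels all unbounded terms (`IsPropagatorOn.hasDerivAt_inner_interaction`).
Since $J(t)$ carries $V(t,|t|^\lambda x)$ to $V(t,x)$, the difference $w=J^{-1}U\psi'-U_S\psi$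
satisfies $\partial_t\langle e^{-icp^2}\varphi,w\rangle=-i\langle V_Se^{-icp^2}\varphi,w\rangle$
with $V_S$ bounded. Duality over the dense set of $\varphi$ and Grönwall's inequality give $w=0$.
The free relation is the case $V=0$.

Since `expA` is only a chosen group with generator $A$, it must also be identified with the explicit
dilations. This follows from existence (`isUnitaryGroup_dilation`) and uniqueness
(`IsUnitaryGroup.unique`). -/

theorem dense_range_toLp (n : ℕ) :
    DenseRange fun φ : 𝓢(Space n, ℂ) => φ.toLp 2 volume :=
  denseRange_toLpCLM (F := ℂ) (μ := (volume : Measure (Space n))) (by norm_num : (2 : ℝ≥0∞) ≠ ⊤)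

theorem toLp_add {n : ℕ} (φ ψ : 𝓢(Space n, ℂ)) :
    (φ + ψ).toLp 2 volume = φ.toLp 2 volume + ψ.toLp 2 volume :=
  map_add (toLpCLM ℂ ℂ 2 (volume : Measure (Space n))) φ ψ

theorem toLp_smul {n : ℕ} (c : ℂ) (φ : 𝓢(Space n, ℂ)) :
    (c • φ).toLp 2 volume = c • φ.toLp 2 volume :=
  map_smul (toLpCLM ℂ ℂ 2 (volume : Measure (Space n))) c φ

/-- Unitary operators that agree on Schwartz functions are equal. -/
theorem unitary_ext {n : ℕ} {W W' : Unitary n}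
    (h : ∀ φ : 𝓢(Space n, ℂ), W (φ.toLp 2 volume) = W' (φ.toLp 2 volume)) : W = W' := by
  have := (dense_range_toLp n).equalizer W.continuous W'.continuous (funext h)
  exact LinearIsometryEquiv.ext fun f => congrFun this f

/-- Strong convergence of unitary operators and convergence of vectors give convergence of the
images. -/
theorem tendsto_unitary_apply {n : ℕ} {α : Type*} {l : Filter α} {W : α → Unitary n}
    {W₀ : Unitary n} {z : α → L2 n} {z₀ : L2 n} (hW : Tendsto (fun s => W s z₀) l (𝓝 (W₀ z₀)))
    (hz : Tendsto z l (𝓝 z₀)) : Tendsto (fun s => W s (z s)) l (𝓝 (W₀ z₀)) := by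
  have h : Tendsto (fun s => W s (z s - z₀)) l (𝓝 0) := by
    rw [tendsto_zero_iff_norm_tendsto_zero]
    simp only [LinearIsometryEquiv.norm_map]
    rw [← tendsto_zero_iff_norm_tendsto_zero]
    simpa using hz.sub_const z₀
  simpa using h.add hW

/-- A product rule: `t ↦ W(a(t)) y(t)` is differentiable where `y(t)` is a Schwartz function. -/
theorem IsUnitaryGroup.hasDerivAt_apply {n : ℕ} {B : 𝓢(Space n, ℂ) → 𝓢(Space n, ℂ)}
    {W : ℝ → Unitary n} (hW : IsUnitaryGroup B W) {a : ℝ → ℝ} {a' : ℝ} {y : ℝ → L2 n} {y' : L2 n}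
    {t : ℝ} {φ : 𝓢(Space n, ℂ)} (ha : HasDerivAt a a' t) (hy : HasDerivAt y y' t)
    (hφ : y t = φ.toLp 2 volume) :
    HasDerivAt (fun s => W (a s) (y s))
      (W (a t) ((a' : ℂ) • (-Complex.I) • (B φ).toLp 2 volume + y')) t := by
  have hgen : HasDerivAt (fun β => W β (φ.toLp 2 volume))
      (W (a t) ((-Complex.I) • (B φ).toLp 2 volume)) (a t) := by
    have h1 : HasDerivAt (fun β => W (β - a t) (φ.toLp 2 volume))
        ((-Complex.I) • (B φ).toLp 2 volume) (a t) := by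
      have h0 := hW.generator φ
      rw [← sub_self (a t)] at h0
      simpa using h0.comp_sub_const (a t) (a t)
    have h2 := ((W (a t) : L2 n ≃L[ℂ] L2 n).toContinuousLinearMap.restrictScalars
      ℝ).hasFDerivAt.comp_hasDerivAt (a t) h1
    refine h2.congr_of_eventuallyEq (Eventually.of_forall fun β => ?_)
    have h3 := hW.add (a t) (β - a t)
    rw [add_sub_cancel] at h3
    simp only [h3]
    rfl
  have hfix := hgen.scomp t ha
  -- The generator acts only on the fixed Schwartz vector `y t`. The slope of the remaining
  -- increment is `W (a s)` applied to the slope of `y`, so strong continuity suffices here.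
  have hinc : HasDerivAt (fun s => W (a s) (y s - y t)) (W (a t) y') t := by
    rw [hasDerivAt_iff_tendsto_slope] at hy ⊢
    have hc : Tendsto (fun s => W (a s) y') (𝓝[≠] t) (𝓝 (W (a t) y')) :=
      (((hW.continuous y').tendsto (a t)).comp ha.continuousAt.tendsto).mono_left
        nhdsWithin_le_nhds
    refine (tendsto_unitary_apply (W := fun s => W (a s)) hc hy).congr fun s => ?_
    have hr : ∀ (r : ℝ) (U : Unitary n) (f : L2 n), U (r • f) = r • U f := fun r U f =>
      map_smul ((U : L2 n ≃L[ℂ] L2 n).toContinuousLinearMap.restrictScalars ℝ) r f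
    simp [slope, vsub_eq_sub, hr]
  have hsum := hfix.add hinc
  refine (hsum.congr_of_eventuallyEq (Eventually.of_forall fun s => ?_)).congr_deriv ?_
  · simp [Function.comp, hφ]
  · rw [map_add, map_smul _ (a' : ℂ)]
    exact congrArg (· + W (a t) y') (RCLike.real_smul_eq_coe_smul (K := ℂ) a' _)

/-- A one-parameter group of unitary operators that is differentiable at `0` on Schwartz functions
is strongly continuous. -/
theorem IsUnitaryGroup.of_generator {n : ℕ} {B : 𝓢(Space n, ℂ) → 𝓢(Space n, ℂ)}
    {W : ℝ → Unitary n} (zero : W 0 = 1) (add : ∀ a b, W (a + b) = W a * W b)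
    (gen : ∀ φ : 𝓢(Space n, ℂ),
      HasDerivAt (fun β => W β (φ.toLp 2 volume)) ((-Complex.I) • (B φ).toLp 2 volume) 0) :
    IsUnitaryGroup B W := by
  refine ⟨zero, add, fun ψ => ?_, gen⟩
  have h0 : ContinuousAt (fun β => W β ψ) 0 := by
    rw [Metric.continuousAt_iff]
    intro ε hε
    obtain ⟨φ, hφ⟩ := (dense_range_toLp n).exists_dist_lt ψ (by positivity : 0 < ε / 3)
    obtain ⟨δ, hδ, h⟩ := Metric.continuousAt_iff.1 (gen φ).continuousAt (ε / 3) (by positivity)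
    refine ⟨δ, hδ, fun β hβ => ?_⟩
    have h1 := h hβ
    have h2 : dist (W β ψ) (W β (φ.toLp 2 volume)) < ε / 3 := by
      rwa [LinearIsometryEquiv.dist_map]
    have h3 : dist (W 0 (φ.toLp 2 volume)) (W 0 ψ) < ε / 3 := by
      rwa [LinearIsometryEquiv.dist_map, dist_comm]
    calc dist (W β ψ) (W 0 ψ) ≤ _ := dist_triangle4 _ _ _ _
      _ < ε / 3 + ε / 3 + ε / 3 := by gcongr
      _ = ε := by ring
  refine continuous_iff_continuousAt.2 fun β₀ => ?_
  have h1 : ContinuousAt (fun β => W (β - β₀) ψ) β₀ :=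
    ContinuousAt.comp (f := fun β => β - β₀) (g := fun β => W β ψ) (by simpa using h0)
      (by fun_prop)
  have h2 := (W β₀).continuous.continuousAt.comp h1
  refine h2.congr (Eventually.of_forall fun β => ?_)
  have h3 := add β₀ (β - β₀)
  rw [add_sub_cancel] at h3
  simp only [h3]
  rfl

/-- A pointwise differentiable family of Schwartz functions, whose orbits are dominated by square
integrable functions, is differentiable in `L²`. -/
theorem hasDerivAt_toLp {n : ℕ} {S : ℝ → 𝓢(Space n, ℂ) → 𝓢(Space n, ℂ)}
    {B : 𝓢(Space n, ℂ) → 𝓢(Space n, ℂ)}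
    (hderiv : ∀ φ x s, HasDerivAt (fun r => S r φ x) (S s (B φ) x) s)
    (hdom : ∀ φ, ∃ g : Space n → ℝ, MemLp g 2 volume ∧ ∀ s, |s| ≤ 1 → ∀ x, ‖S s φ x‖ ≤ g x)
    (φ : 𝓢(Space n, ℂ)) :
    HasDerivAt (fun s => (S s φ).toLp 2 volume)
      ((S 0 (B φ)).toLp 2 volume) 0 := by
  -- The second derivative of the orbit is the orbit of `B (B φ)`. Two applications of the mean
  -- value inequality bound the first-order Taylor remainder pointwise by `g x * |s| ^ 2`, hence by
  -- $O(s^2)$ in $L^2$.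
  obtain ⟨g, hg, hgb⟩ := hdom (B (B φ))
  have hfirst : ∀ s, |s| ≤ 1 → ∀ x, ‖S s (B φ) x - S 0 (B φ) x‖ ≤ g x * |s| := by
    intro s hs x
    have := (convex_Icc (-|s|) |s|).norm_image_sub_le_of_norm_hasDerivWithin_le
      (f := fun r => S r (B φ) x) (C := g x) (x := 0) (y := s)
      (fun r _ => (hderiv (B φ) x r).hasDerivWithinAt)
      (fun r hr => hgb r ((abs_le.2 hr).trans hs) x) (Set.mem_Icc.2 (by simp))
      ⟨neg_abs_le s, le_abs_self s⟩
    simpa using this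
  have hsecond : ∀ s, |s| ≤ 1 → ∀ x,
      ‖S s φ x - S 0 φ x - s * S 0 (B φ) x‖ ≤ g x * |s| ^ 2 := by
    intro s hs x
    have := (convex_Icc (-|s|) |s|).norm_image_sub_le_of_norm_hasDerivWithin_le
      (f := fun r => S r φ x - r * S 0 (B φ) x) (f' := fun r => S r (B φ) x - S 0 (B φ) x)
      (C := g x * |s|) (x := 0) (y := s)
      (fun r _ => ((hderiv φ x r).sub (by
        simpa using (Complex.ofRealCLM.hasDerivAt (x := r)).mul_const
          (S 0 (B φ) x))).hasDerivWithinAt)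
      (fun r hr => ?_) (Set.mem_Icc.2 (by simp)) ⟨neg_abs_le s, le_abs_self s⟩
    · simp only [sub_zero, Complex.ofReal_zero, zero_mul, Real.norm_eq_abs] at this
      rw [sub_right_comm, pow_two, ← mul_assoc]
      exact this
    · refine (hfirst r ((abs_le.2 hr).trans hs) x).trans ?_
      have : 0 ≤ g x := (norm_nonneg _).trans (hgb 0 (by simp) x)
      have := abs_le.2 hr
      gcongr
  rw [hasDerivAt_iff_isLittleO]
  have hbig : (fun s : ℝ => (S s φ).toLp 2 volume - (S 0 φ).toLp 2 volume -
      (s - 0) • (S 0 (B φ)).toLp 2 volume) =O[𝓝 0] fun s : ℝ => s ^ 2 := by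
    refine Asymptotics.IsBigO.of_bound ‖hg.toLp‖ ?_
    filter_upwards [Metric.closedBall_mem_nhds (0 : ℝ) one_pos] with s hs
    have hs' : |s| ≤ 1 := by simpa using hs
    rw [mul_comm]
    refine Lp.norm_le_mul_norm_of_ae_le_mul ?_
    filter_upwards [(S s φ).coeFn_toLp 2 (volume : Measure (Space n)),
      (S 0 φ).coeFn_toLp 2 (volume : Measure (Space n)),
      (S 0 (B φ)).coeFn_toLp 2 (volume : Measure (Space n)), hg.coeFn_toLp,
      Lp.coeFn_sub ((S s φ).toLp 2 volume - (S 0 φ).toLp 2 volume)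
        ((s - 0) • (S 0 (B φ)).toLp 2 volume),
      Lp.coeFn_sub ((S s φ).toLp 2 volume) ((S 0 φ).toLp 2 volume),
      Lp.coeFn_smul (s - 0) ((S 0 (B φ)).toLp 2 volume)]
      with x h1 h2 h3 h4 h5 h6 h7
    have h8 := hsecond s hs' x
    rw [h5, Pi.sub_apply, h6, Pi.sub_apply, h7, Pi.smul_apply, h1, h2, h3, h4, sub_zero,
      Complex.real_smul]
    refine h8.trans ?_
    have := le_abs_self (g x)
    rw [mul_comm, Real.norm_eq_abs, Real.norm_eq_abs, abs_pow]
    gcongr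
  refine hbig.trans_isLittleO ?_
  have := Asymptotics.isLittleO_pow_id (𝕜 := ℝ) one_lt_two
  simpa using this

/-- Two unitary groups with the same generator on Schwartz functions agree if one of them leaves
the space of Schwartz functions invariant. -/
theorem IsUnitaryGroup.unique {n : ℕ} {B : 𝓢(Space n, ℂ) → 𝓢(Space n, ℂ)}
    {W W' : ℝ → Unitary n} (hW : IsUnitaryGroup B W) (hW' : IsUnitaryGroup B W')
    (hinv : ∀ β (φ : 𝓢(Space n, ℂ)), ∃ χ : 𝓢(Space n, ℂ),
      W' β (φ.toLp 2 volume) = χ.toLp 2 volume) : W = W' := by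
  funext β
  refine unitary_ext fun φ => ?_
  -- This path joins `W β φ` to `W' β φ`. Because `W' r φ` is again Schwartz, the generator is known
  -- on it and the two contributions cancel.
  have hconst : ∀ s, HasDerivAt (fun r => W (β - r) (W' r (φ.toLp 2 volume))) 0 s := by
    intro s
    obtain ⟨χ, hχ⟩ := hinv s φ
    have h1 : HasDerivAt (fun r => W' r (φ.toLp 2 volume))
        ((-Complex.I) • (B χ).toLp 2 volume) s := by
      have h0 := hW'.generator χ
      rw [← sub_self s] at h0
      refine (h0.comp_sub_const s s).congr_of_eventuallyEq (Eventually.of_forall fun r => ?_)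
      have h3 := hW'.add (r - s) s
      rw [sub_add_cancel] at h3
      simp only [h3, ← hχ]
      rfl
    have h2 : HasDerivAt (fun r => β - r) (-1) s := by
      simpa using (hasDerivAt_id s).const_sub β
    convert hW.hasDerivAt_apply h2 h1 hχ using 1
    simp
  have h := is_const_of_deriv_eq_zero (fun s => (hconst s).differentiableAt)
    (fun s => (hconst s).deriv) 0 β
  simpa [hW.zero, hW'.zero] using h

open scoped FourierTransform

/-! ### Position and momentum on Schwartz functions -/

section Operators

variable {n : ℕ}

theorem posOp_add (j : Fin n) (φ ψ : 𝓢(Space n, ℂ)) : posOp j (φ + ψ) = posOp j φ + posOp j ψ :=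
  map_add _ _ _

theorem posOp_smul (j : Fin n) (c : ℂ) (φ : 𝓢(Space n, ℂ)) : posOp j (c • φ) = c • posOp j φ :=
  map_smul _ _ _

theorem momOp_add (j : Fin n) (φ ψ : 𝓢(Space n, ℂ)) : momOp j (φ + ψ) = momOp j φ + momOp j ψ := by
  simp [momOp, LineDeriv.lineDerivOp_add]

theorem momOp_smul (j : Fin n) (c : ℂ) (φ : 𝓢(Space n, ℂ)) : momOp j (c • φ) = c • momOp j φ := by
  simp only [momOp, LineDeriv.lineDerivOp_smul]
  rw [smul_comm]

theorem posSq_apply (φ : 𝓢(Space n, ℂ)) (x : Space n) : posSq φ x = ((‖x‖ ^ 2 : ℝ) : ℂ) * φ x := by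
  simp only [posSq, sum_apply, posOp_apply, ← mul_assoc, ← Finset.sum_mul,
    EuclideanSpace.norm_sq_eq, Real.norm_eq_abs, sq_abs]
  push_cast
  simp only [pow_two]

theorem hasFDerivAt_schwartz (φ : 𝓢(Space n, ℂ)) (x : Space n) :
    HasFDerivAt φ (fderiv ℝ φ x) x :=
  φ.differentiableAt.hasFDerivAt

theorem sum_coord_mul_fderiv (φ : 𝓢(Space n, ℂ)) (x : Space n) :
    ∑ j, ((x j : ℝ) : ℂ) * fderiv ℝ φ x (EuclideanSpace.single j (1 : ℝ)) = fderiv ℝ φ x x := by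
  conv_rhs => enter [2]; rw [← (EuclideanSpace.basisFun (Fin n) ℝ).sum_repr x]
  simp [map_sum]

theorem momOp_posOp_apply (j : Fin n) (φ : 𝓢(Space n, ℂ)) (x : Space n) :
    momOp j (posOp j φ) x = -Complex.I * φ x + posOp j (momOp j φ) x := by
  have h1 : HasFDerivAt (fun x : Space n => ((x j : ℝ) : ℂ))
      (Complex.ofRealCLM.comp (EuclideanSpace.proj (𝕜 := ℝ) j)) x :=
    (Complex.ofRealCLM.comp (EuclideanSpace.proj (𝕜 := ℝ) j)).hasFDerivAt
  have h2 := h1.mul (hasFDerivAt_schwartz φ x)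
  have h3 : (posOp j φ : Space n → ℂ) = fun x => ((x j : ℝ) : ℂ) * φ x :=
    funext fun x => posOp_apply j φ x
  rw [momOp_apply, h3, posOp_apply, momOp_apply]
  erw [h2.fderiv]
  simp
  ring

/-- Each commutator $[p_j,x_j]=-i$ contributes once, which gives the term with $n$. In this form $A$
can be compared with the derivative of a dilation. -/
theorem dilationGen_apply (φ : 𝓢(Space n, ℂ)) (x : Space n) :
    dilationGen φ x = -Complex.I * (n * φ x + 2 * fderiv ℝ φ x x) := by
  have h : ∀ j : Fin n, (posOp j (momOp j φ) + momOp j (posOp j φ)) x = -Complex.I * φ x +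
      (-2 * Complex.I) * (((x j : ℝ) : ℂ) * fderiv ℝ φ x (EuclideanSpace.single j (1 : ℝ))) := by
    intro j
    rw [add_apply, momOp_posOp_apply, posOp_apply, momOp_apply]
    ring
  rw [dilationGen, sum_apply, Finset.sum_congr rfl fun j _ => h j, Finset.sum_add_distrib,
    ← Finset.mul_sum Finset.univ _ (-2 * Complex.I), sum_coord_mul_fderiv, Finset.sum_const,
    Finset.card_univ, Fintype.card_fin, nsmul_eq_mul]
  ring

end Operators

/-! ### The phase group -/

/-- The $k$-th derivative is $i^k$ times the function, so every derivative has modulus one. -/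
theorem hasTemperateGrowth_exp_I :
    (fun t : ℝ => Complex.exp (Complex.I * (t : ℂ))).HasTemperateGrowth := by
  have hd : ∀ k : ℕ, iteratedDeriv k (fun t : ℝ => Complex.exp (Complex.I * (t : ℂ))) =
      fun t : ℝ => Complex.I ^ k * Complex.exp (Complex.I * (t : ℂ)) := by
    intro k
    induction k with
    | zero => simp
    | succ k ih =>
      funext t
      rw [iteratedDeriv_succ, ih]
      have h1 : HasDerivAt (fun t : ℝ => Complex.I * (t : ℂ)) Complex.I t := by
        simpa using (Complex.ofRealCLM.hasDerivAt (x := t)).const_mul Complex.I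
      rw [(h1.cexp.const_mul (Complex.I ^ k)).deriv]
      ring
  refine ⟨(contDiff_const.mul Complex.ofRealCLM.contDiff).cexp, fun k => ⟨0, 1, fun t => ?_⟩⟩
  rw [norm_iteratedFDeriv_eq_norm_iteratedDeriv, hd, norm_mul, norm_pow, Complex.norm_I,
    mul_comm Complex.I, Complex.norm_exp_ofReal_mul_I]
  simp

theorem hasTemperateGrowth_phase {n : ℕ} (c : ℝ) :
    (fun x : Space n => Complex.exp (Complex.I * ((c * ‖x‖ ^ 2 : ℝ) : ℂ))).HasTemperateGrowth := by
  have h : (fun x : Space n => c * ‖x‖ ^ 2).HasTemperateGrowth :=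
    (Function.HasTemperateGrowth.const c).mul (Function.hasTemperateGrowth_norm_sq (Space n))
  exact hasTemperateGrowth_exp_I.comp h

/-- Multiplication of a Schwartz function by `exp(i c |x|²)`. -/
noncomputable def phaseSchwartz {n : ℕ} (c : ℝ) : 𝓢(Space n, ℂ) →L[ℂ] 𝓢(Space n, ℂ) :=
  smulLeftCLM ℂ fun x : Space n => Complex.exp (Complex.I * ((c * ‖x‖ ^ 2 : ℝ) : ℂ))

section Phase

variable {n : ℕ}

theorem phaseSchwartz_apply (c : ℝ) (φ : 𝓢(Space n, ℂ)) (x : Space n) :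
    phaseSchwartz c φ x = Complex.exp (Complex.I * ((c * ‖x‖ ^ 2 : ℝ) : ℂ)) * φ x := by
  rw [phaseSchwartz, smulLeftCLM_apply_apply (hasTemperateGrowth_phase c), smul_eq_mul]

theorem norm_phaseSchwartz_apply (c : ℝ) (φ : 𝓢(Space n, ℂ)) (x : Space n) :
    ‖phaseSchwartz c φ x‖ = ‖φ x‖ := by
  rw [phaseSchwartz_apply, norm_mul, mul_comm Complex.I, Complex.norm_exp_ofReal_mul_I, one_mul]

theorem phaseSchwartz_zero (φ : 𝓢(Space n, ℂ)) : phaseSchwartz 0 φ = φ := by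
  ext x
  simp [phaseSchwartz_apply]

theorem coeFn_phase (c : ℝ) (f : L2 n) :
    phase c f =ᵐ[volume] fun x => Complex.exp (Complex.I * ((c * ‖x‖ ^ 2 : ℝ) : ℂ)) * f x :=
  (phase_memLp c f).coeFn_toLp

theorem phase_toLp (c : ℝ) (φ : 𝓢(Space n, ℂ)) :
    phase c (φ.toLp 2 volume) = (phaseSchwartz c φ).toLp 2 volume := by
  apply Lp.ext
  filter_upwards [coeFn_phase c (φ.toLp 2 volume), φ.coeFn_toLp 2 volume,
    (phaseSchwartz c φ).coeFn_toLp 2 volume] with x h1 h2 h3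
  rw [h1, h2, h3, phaseSchwartz_apply]

theorem phase_zero : phase (n := n) 0 = 1 :=
  unitary_ext fun φ => by rw [phase_toLp, phaseSchwartz_zero]; rfl

theorem phase_add (a b : ℝ) : phase (n := n) (a + b) = phase a * phase b := by
  refine unitary_ext fun φ => ?_
  change _ = phase a (phase b _)
  rw [phase_toLp, phase_toLp, phase_toLp]
  congr 1
  ext x
  rw [phaseSchwartz_apply, phaseSchwartz_apply, phaseSchwartz_apply, ← mul_assoc,
    ← Complex.exp_add]
  congr 2
  push_cast
  ring

theorem hasDerivAt_phaseSchwartz (φ : 𝓢(Space n, ℂ)) (x : Space n) (s : ℝ) :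
    HasDerivAt (fun r => phaseSchwartz r φ x) (phaseSchwartz s (Complex.I • posSq φ) x) s := by
  simp only [phaseSchwartz_apply, smul_apply, posSq_apply]
  have h1 : HasDerivAt (fun r : ℝ => Complex.I * ((r * ‖x‖ ^ 2 : ℝ) : ℂ))
      (Complex.I * ((‖x‖ ^ 2 : ℝ) : ℂ)) s := by
    have h2 := ((hasDerivAt_id s).mul_const (‖x‖ ^ 2)).ofReal_comp
    simpa using h2.const_mul Complex.I
  refine (h1.cexp.mul_const (φ x)).congr_deriv ?_
  rw [smul_eq_mul]
  ring

/-- `c ↦ e^{i c x²}` is the unitary group generated by `-x²`. -/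
theorem isUnitaryGroup_phase :
    IsUnitaryGroup (fun φ : 𝓢(Space n, ℂ) => -posSq φ) (phase (n := n)) := by
  refine .of_generator phase_zero phase_add fun φ => ?_
  have h := hasDerivAt_toLp (S := fun c : ℝ => phaseSchwartz (n := n) c)
    (B := fun φ => Complex.I • posSq φ) hasDerivAt_phaseSchwartz
    (fun φ => ⟨fun x => ‖φ x‖, (φ.memLp 2 volume).norm, fun s _ x =>
      (norm_phaseSchwartz_apply s φ x).le⟩) φ
  simp only [phase_toLp]
  refine h.congr_deriv ?_
  rw [phaseSchwartz_zero, ← toLp_smul]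
  simp

/-- A gauge transformation: the gradient $2cx$ of $c|x|^2$ shifts the momentum. -/
theorem momOp_phaseSchwartz (c : ℝ) (j : Fin n) (φ : 𝓢(Space n, ℂ)) :
    momOp j (phaseSchwartz c φ) = phaseSchwartz c (momOp j φ + ((2 * c : ℝ) : ℂ) • posOp j φ) := by
  ext x
  have h1 : HasFDerivAt (fun x : Space n => Complex.I * ((c * ‖x‖ ^ 2 : ℝ) : ℂ))
      (Complex.I • Complex.ofRealCLM.comp (c • (2 • innerSL ℝ x))) x := by
    have h2 : HasFDerivAt (fun x : Space n => c * ‖x‖ ^ 2) (c • (2 • innerSL ℝ x)) x :=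
      (hasStrictFDerivAt_norm_sq x).hasFDerivAt.const_mul c
    exact (Complex.ofRealCLM.hasFDerivAt.comp x h2).const_mul Complex.I
  have h3 := h1.cexp.mul (hasFDerivAt_schwartz φ x)
  have h4 : (phaseSchwartz c φ : Space n → ℂ) =
      fun x => Complex.exp (Complex.I * ((c * ‖x‖ ^ 2 : ℝ) : ℂ)) * φ x :=
    funext fun x => phaseSchwartz_apply c φ x
  rw [momOp_apply, h4, phaseSchwartz_apply, add_apply, smul_apply,
    posOp_apply, momOp_apply]
  erw [h3.fderiv]
  simp [EuclideanSpace.inner_single_right]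
  linear_combination (-2 * φ x * Complex.exp (Complex.I * (c * ‖x‖ ^ 2)) * c * x j) * Complex.I_sq

/-- Conjugation of the kinetic energy by a phase. -/
theorem momSq_phaseSchwartz (c : ℝ) (φ : 𝓢(Space n, ℂ)) :
    momSq (phaseSchwartz c φ) = phaseSchwartz c
      (momSq φ + ((2 * c : ℝ) : ℂ) • dilationGen φ + ((4 * c ^ 2 : ℝ) : ℂ) • posSq φ) := by
  simp only [momSq, posSq, dilationGen, Finset.smul_sum, ← Finset.sum_add_distrib]
  rw [map_sum]
  refine Finset.sum_congr rfl fun j _ => ?_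
  rw [momOp_phaseSchwartz, momOp_phaseSchwartz]
  congr 1
  -- Expanding $(p_j+2cx_j)^2$ without reordering factors leaves the cross terms in the symmetric
  -- form that defines $A$.
  simp only [momOp_add, momOp_smul, posOp_add, posOp_smul, smul_add, smul_smul]
  have : ((2 * c : ℝ) : ℂ) * ((2 * c : ℝ) : ℂ) = ((4 * c ^ 2 : ℝ) : ℂ) := by
    push_cast
    ring
  rw [this]
  abel

end Phase

/-! ### The free Schrödinger group -/

/-- The unitary group `c ↦ e^{-i c p²}` on `L²(ℝⁿ)`. -/
noncomputable def freeGroup (n : ℕ) (c : ℝ) : Unitary n :=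
  ((Lp.fourierTransformₗᵢ (Space n) ℂ).trans (phase (-(4 * Real.pi ^ 2) * c))).trans
    (Lp.fourierTransformₗᵢ (Space n) ℂ).symm

/-- The unitary group `c ↦ e^{-i c p²}` on Schwartz functions. -/
noncomputable def freeSchwartz {n : ℕ} (c : ℝ) (φ : 𝓢(Space n, ℂ)) : 𝓢(Space n, ℂ) :=
  𝓕⁻ (phaseSchwartz (-(4 * Real.pi ^ 2) * c) (𝓕 φ))

section Free

variable {n : ℕ}

theorem freeGroup_toLp (c : ℝ) (φ : 𝓢(Space n, ℂ)) :
    freeGroup n c (φ.toLp 2 volume) = (freeSchwartz c φ).toLp 2 volume := by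
  change 𝓕⁻ (phase _ (𝓕 (φ.toLp 2 volume))) = _
  rw [toLp_fourier_eq, phase_toLp, toLp_fourierInv_eq]
  rfl

/-- The Fourier kernel is $e^{-2\pi i\langle x,\xi\rangle}$; this is the source of the factor
$4\pi^2$ in `freeGroup`. -/
theorem fourier_momOp (j : Fin n) (φ : 𝓢(Space n, ℂ)) :
    𝓕 (momOp j φ) = ((2 * Real.pi : ℝ) : ℂ) • posOp j (𝓕 φ) := by
  have h1 : 𝓕 (momOp j φ) = (-Complex.I) • 𝓕 (∂_{EuclideanSpace.single j (1 : ℝ)} φ) :=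
    FourierTransform.fourier_smul _ _
  have h2 : (inner ℝ · (EuclideanSpace.single j (1 : ℝ)) : Space n → ℝ).HasTemperateGrowth := by
    fun_prop
  rw [h1, fourier_lineDerivOp_eq]
  ext x
  simp only [smul_apply, smulLeftCLM_apply_apply h2, posOp_apply]
  simp [EuclideanSpace.inner_single_right]
  linear_combination (-2 * Real.pi * x j * 𝓕 φ x) * Complex.I_sq

theorem fourier_momSq (φ : 𝓢(Space n, ℂ)) :
    𝓕 (momSq φ) = ((4 * Real.pi ^ 2 : ℝ) : ℂ) • posSq (𝓕 φ) := by
  have h1 : 𝓕 (momSq φ) = ∑ j, 𝓕 (momOp j (momOp j φ)) :=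
    map_sum (fourierTransformCLM ℂ) _ _
  rw [h1, posSq, Finset.smul_sum]
  refine Finset.sum_congr rfl fun j _ => ?_
  rw [fourier_momOp, fourier_momOp, posOp_smul, smul_smul]
  congr 1
  push_cast
  ring

/-- `c ↦ e^{-i c p²}` is the unitary group generated by `p²`. -/
theorem isUnitaryGroup_freeGroup : IsUnitaryGroup (momSq (n := n)) (freeGroup n) := by
  refine .of_generator ?_ ?_ fun φ => ?_
  · ext1 f
    simp [freeGroup, phase_zero]
  · intro a b
    ext1 f
    simp [freeGroup, mul_add, phase_add]
  · have h1 := isUnitaryGroup_phase.generator (𝓕 φ)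
    have h2 : HasDerivAt (fun c : ℝ => -(4 * Real.pi ^ 2) * c) (-(4 * Real.pi ^ 2)) 0 := by
      simpa using (hasDerivAt_id (0 : ℝ)).const_mul (-(4 * Real.pi ^ 2))
    have h3 := (isUnitaryGroup_phase (n := n)).hasDerivAt_apply (t := 0) (φ := 𝓕 φ) h2
      (hasDerivAt_const (0 : ℝ) ((𝓕 φ).toLp 2 volume)) rfl
    have h4 := ((Lp.fourierTransformₗᵢ (Space n) ℂ).symm :
      L2 n ≃L[ℂ] L2 n).toContinuousLinearMap.restrictScalars ℝ |>.hasFDerivAt.comp_hasDerivAt 0 h3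
    have h5 : HasDerivAt (fun c => freeGroup n c (φ.toLp 2 volume))
        (𝓕⁻ (phase (-(4 * Real.pi ^ 2) * 0) (((-(4 * Real.pi ^ 2) : ℝ) : ℂ) • (-Complex.I) •
          (-posSq (𝓕 φ)).toLp 2 volume + 0))) 0 := by
      refine h4.congr_of_eventuallyEq (Eventually.of_forall fun c => ?_)
      change 𝓕⁻ (phase _ (𝓕 (φ.toLp 2 volume))) = _
      rw [toLp_fourier_eq]
      rfl
    refine h5.congr_deriv ?_
    rw [mul_zero, phase_zero, add_zero, LinearIsometryEquiv.coe_one, id, ← toLp_smul, ← toLp_smul,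
      toLp_fourierInv_eq, ← toLp_smul]
    congr 1
    have h6 : ((-(4 * Real.pi ^ 2) : ℝ) : ℂ) • (-Complex.I) • (-posSq (𝓕 φ)) =
        𝓕 ((-Complex.I) • momSq φ) := by
      rw [FourierTransform.fourier_smul, fourier_momSq, smul_comm]
      simp
    rw [h6, FourierTransform.fourierInv_fourier_eq]

end Free

/-! ### The dilation group -/

section Dilation

variable {n : ℕ}

theorem map_exp_smul_volume (β : ℝ) :
    Measure.map (fun x : Space n => Real.exp (-2 * β) • x) volume =
      ENNReal.ofReal (Real.exp (2 * (n * β))) • (volume : Measure (Space n)) := by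
  rw [Measure.map_addHaar_smul volume (Real.exp_pos _).ne', finrank_euclideanSpace_fin,
    ← Real.exp_nat_mul, ← Real.exp_neg, Real.abs_exp]
  congr 3
  ring

/-- Allows almost-everywhere identities to be composed with a dilation. -/
theorem quasiMeasurePreserving_exp_smul (β : ℝ) :
    Measure.QuasiMeasurePreserving (fun x : Space n => Real.exp (-2 * β) • x) volume volume :=
  ⟨by fun_prop, by rw [map_exp_smul_volume]; exact Measure.smul_absolutelyContinuous⟩

/-- The change of variables multiplies the squared norm by $e^{2n\beta}$, and the prefactor
$e^{-n\beta}$ compensates for its square root. -/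
theorem eLpNorm_dilate (β : ℝ) {f : Space n → ℂ} (hf : AEStronglyMeasurable f volume) :
    eLpNorm (fun x => ((Real.exp (-(n * β)) : ℝ) : ℂ) * f (Real.exp (-2 * β) • x)) 2 volume =
      eLpNorm f 2 volume := by
  have h1 := eLpNorm_const_smul ((Real.exp (-(n * β)) : ℝ) : ℂ)
    (fun x : Space n => f (Real.exp (-2 * β) • x)) 2 volume
  have h2 : eLpNorm (fun x : Space n => f (Real.exp (-2 * β) • x)) 2 volume =
      eLpNorm f 2 (Measure.map (fun x : Space n => Real.exp (-2 * β) • x) volume) := by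
    rw [eLpNorm_map_measure _ (by fun_prop)]
    · rfl
    · rw [map_exp_smul_volume]
      exact hf.smul_measure _
  have h3 : ‖((Real.exp (-(n * β)) : ℝ) : ℂ)‖ₑ = ENNReal.ofReal (Real.exp (-(n * β))) := by
    rw [← ofReal_norm, Complex.norm_real, Real.norm_eq_abs, Real.abs_exp]
  refine h1.trans ?_
  rw [h2, map_exp_smul_volume, eLpNorm_smul_measure_of_ne_top (by simp), h3, smul_eq_mul,
    ← mul_assoc, ENNReal.ofReal_rpow_of_pos (Real.exp_pos _),
    ← ENNReal.ofReal_mul (Real.exp_pos _).le, ← Real.exp_mul, ← Real.exp_add]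
  have h4 : -(n * β) + 2 * (n * β) * (1 / (2 : ℝ≥0∞)).toReal = 0 := by
    simp
    ring
  rw [h4]
  simp

theorem dilate_memLp (β : ℝ) (f : L2 n) :
    MemLp (fun x => ((Real.exp (-(n * β)) : ℝ) : ℂ) * f (Real.exp (-2 * β) • x)) 2
      (volume : Measure (Space n)) := by
  refine ⟨?_, ?_⟩
  · exact ((Lp.aestronglyMeasurable f).comp_quasiMeasurePreserving
      (quasiMeasurePreserving_exp_smul β)).const_mul _
  · rw [eLpNorm_dilate β (Lp.aestronglyMeasurable f)]
    exact (Lp.memLp f).2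

theorem dilate_dilate (a b : ℝ) (f : L2 n) :
    (dilate_memLp a (dilate_memLp b f).toLp).toLp = (dilate_memLp (a + b) f).toLp := by
  apply Lp.ext
  filter_upwards [(dilate_memLp a (dilate_memLp b f).toLp).coeFn_toLp,
    (quasiMeasurePreserving_exp_smul a).ae (dilate_memLp b f).coeFn_toLp,
    (dilate_memLp (a + b) f).coeFn_toLp] with x h1 h2 h3
  rw [h1, h2, h3, smul_smul, ← Real.exp_add, ← mul_assoc, ← Complex.ofReal_mul, ← Real.exp_add,
    mul_add, mul_add, neg_add, add_comm (-2 * b)]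

theorem dilate_zero (f : L2 n) : (dilate_memLp 0 f).toLp = f := by
  apply Lp.ext
  filter_upwards [(dilate_memLp 0 f).coeFn_toLp] with x h
  rw [h]
  simp

/-- The unitary dilation `(dilation β f)(x) = e^{-nβ} f(e^{-2β} x)` of `L²(ℝⁿ)`. -/
noncomputable def dilation (n : ℕ) (β : ℝ) : Unitary n where
  toFun f := (dilate_memLp β f).toLp
  invFun f := (dilate_memLp (-β) f).toLp
  left_inv f := (dilate_dilate (-β) β f).trans (by
    convert dilate_zero f using 4 <;> simp)
  right_inv f := (dilate_dilate β (-β) f).trans (by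
    convert dilate_zero f using 4 <;> simp)
  map_add' f g := by
    apply Lp.ext
    filter_upwards [(dilate_memLp β (f + g)).coeFn_toLp, (dilate_memLp β f).coeFn_toLp,
      (dilate_memLp β g).coeFn_toLp,
      (quasiMeasurePreserving_exp_smul β).ae (Lp.coeFn_add f g),
      Lp.coeFn_add ((dilate_memLp β f).toLp) ((dilate_memLp β g).toLp)] with x h1 h2 h3 h4 h5
    rw [h1, h5, Pi.add_apply, h2, h3, h4, Pi.add_apply, mul_add]
  map_smul' a f := by
    apply Lp.ext
    filter_upwards [(dilate_memLp β (a • f)).coeFn_toLp, (dilate_memLp β f).coeFn_toLp,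
      (quasiMeasurePreserving_exp_smul β).ae (Lp.coeFn_smul a f),
      Lp.coeFn_smul a ((dilate_memLp β f).toLp)] with x h1 h2 h3 h4
    simp only [RingHom.id_apply]
    rw [h1, h4, Pi.smul_apply, h2, h3, Pi.smul_apply, smul_eq_mul, smul_eq_mul]
    ring
  norm_map' f := by
    change ‖(dilate_memLp β f).toLp‖ = ‖f‖
    rw [Lp.norm_toLp, Lp.norm_def, eLpNorm_dilate β (Lp.aestronglyMeasurable f)]

theorem coeFn_dilation (β : ℝ) (f : L2 n) : dilation n β f =ᵐ[volume] fun x =>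
    ((Real.exp (-(n * β)) : ℝ) : ℂ) * f (Real.exp (-2 * β) • x) :=
  (dilate_memLp β f).coeFn_toLp

/-- Dilation by a positive factor as a linear homeomorphism. -/
noncomputable def expSmulEquiv (n : ℕ) (β : ℝ) : Space n ≃L[ℝ] Space n :=
  ContinuousLinearEquiv.smulLeft (Units.mk0 (Real.exp (-2 * β)) (Real.exp_pos _).ne')

/-- The dilation `e^{-nβ} φ(e^{-2β} x)` of a Schwartz function. -/
noncomputable def dilationSchwartz (β : ℝ) (φ : 𝓢(Space n, ℂ)) : 𝓢(Space n, ℂ) :=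
  ((Real.exp (-(n * β)) : ℝ) : ℂ) • compCLMOfContinuousLinearEquiv ℂ (expSmulEquiv n β) φ

theorem dilationSchwartz_apply (β : ℝ) (φ : 𝓢(Space n, ℂ)) (x : Space n) :
    dilationSchwartz β φ x =
      ((Real.exp (-(n * β)) : ℝ) : ℂ) * φ (Real.exp (-2 * β) • x) := rfl

theorem dilationSchwartz_smul (β : ℝ) (c : ℂ) (φ : 𝓢(Space n, ℂ)) :
    dilationSchwartz β (c • φ) = c • dilationSchwartz β φ := by
  rw [dilationSchwartz, map_smul, smul_comm]
  rfl

theorem dilation_toLp (β : ℝ) (φ : 𝓢(Space n, ℂ)) :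
    dilation n β (φ.toLp 2 volume) = (dilationSchwartz β φ).toLp 2 volume := by
  apply Lp.ext
  filter_upwards [coeFn_dilation β (φ.toLp 2 volume),
    (quasiMeasurePreserving_exp_smul β).ae (φ.coeFn_toLp 2 volume),
    (dilationSchwartz β φ).coeFn_toLp 2 volume] with x h1 h2 h3
  rw [h1, h2, h3, dilationSchwartz_apply]

theorem dilationSchwartz_zero (φ : 𝓢(Space n, ℂ)) : dilationSchwartz 0 φ = φ := by
  ext x
  simp [dilationSchwartz_apply]

theorem hasDerivAt_dilationSchwartz (φ : 𝓢(Space n, ℂ)) (x : Space n) (s : ℝ) :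
    HasDerivAt (fun r => dilationSchwartz r φ x)
      (dilationSchwartz s ((-Complex.I) • dilationGen φ) x) s := by
  simp only [dilationSchwartz_apply, smul_apply, dilationGen_apply]
  have h1 : HasDerivAt (fun r : ℝ => ((Real.exp (-(n * r)) : ℝ) : ℂ))
      ((Real.exp (-(n * s)) * (-n) : ℝ) : ℂ) s := by
    have := ((hasDerivAt_id s).const_mul (n : ℝ)).neg.exp.ofReal_comp
    simpa using this
  have h2 : HasDerivAt (fun r : ℝ => Real.exp (-2 * r) • x)
      ((-2 : ℝ) • Real.exp (-2 * s) • x) s := by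
    have := ((hasDerivAt_id s).const_mul (-2 : ℝ)).exp.smul_const x
    refine this.congr_deriv ?_
    rw [smul_smul]
    simp [mul_comm]
  have h3 := (hasFDerivAt_schwartz φ (Real.exp (-2 * s) • x)).comp_hasDerivAt s h2
  refine (h1.mul h3).congr_deriv ?_
  rw [map_smul _ (-2 : ℝ), smul_eq_mul, Complex.real_smul]
  push_cast
  simp only [Function.comp]
  linear_combination (-Complex.exp (-(n * s)) * (n * φ (Real.exp (-2 * s) • x) +
    2 * fderiv ℝ φ (Real.exp (-2 * s) • x) (Real.exp (-2 * s) • x))) * Complex.I_sq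

/-- Provides the domination required by `hasDerivAt_toLp`. The exponent `k` makes $(1+|x|)^{-k}$
square integrable, and for $|s|\le1$ the weights at $x$ and $e^{-2s}x$ are comparable: $1+|x|\le
e^2(1+|e^{-2s}x|)$. -/
theorem dilationSchwartz_dominated (φ : 𝓢(Space n, ℂ)) : ∃ g : Space n → ℝ, MemLp g 2 volume ∧
    ∀ s, |s| ≤ 1 → ∀ x, ‖dilationSchwartz s φ x‖ ≤ g x := by
  obtain ⟨k, hk⟩ := Measure.HasTemperateGrowth.exists_eLpNorm_lt_top 2
    (μ := (volume : Measure (Space n))) inferInstance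
  set C : ℝ := 2 ^ k * (Finset.Iic (k, 0)).sup (fun m => SchwartzMap.seminorm ℂ m.1 m.2) φ
  have hC : ∀ x : Space n, (1 + ‖x‖) ^ k * ‖φ x‖ ≤ C := fun x => by
    simpa using one_add_le_sup_seminorm_apply (𝕜 := ℂ) (m := (k, 0)) le_rfl le_rfl φ x
  have hg : MemLp (fun x : Space n => (1 + ‖x‖) ^ (-k : ℝ)) 2 volume := by
    refine ⟨Continuous.aestronglyMeasurable ?_, hk⟩
    exact (by fun_prop : Continuous fun x : Space n => 1 + ‖x‖).rpow_const
      fun x => Or.inl (by positivity)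
  refine ⟨_, hg.const_mul (Real.exp n * (C * Real.exp 2 ^ k)), fun s hs x => ?_⟩
  obtain ⟨hs1, hs2⟩ := abs_le.1 hs
  rw [dilationSchwartz_apply, norm_mul, Complex.norm_real, Real.norm_eq_abs, Real.abs_exp, mul_assoc]
  have h1 : Real.exp (-(n * s)) ≤ Real.exp n := by
    rw [Real.exp_le_exp]
    have : (0 : ℝ) ≤ n := Nat.cast_nonneg n
    nlinarith
  have h2 : 1 + ‖x‖ ≤ Real.exp 2 * (1 + ‖Real.exp (-2 * s) • x‖) := by
    rw [norm_smul, Real.norm_eq_abs, Real.abs_exp, mul_add, ← mul_assoc, ← Real.exp_add, mul_one]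
    have h3 : 1 ≤ Real.exp 2 := Real.one_le_exp (by norm_num)
    have h4 : 1 ≤ Real.exp (2 + -2 * s) := Real.one_le_exp (by linarith)
    nlinarith [norm_nonneg x]
  have hpos : 0 < (1 + ‖x‖) ^ k := by positivity
  have h5 : ‖φ (Real.exp (-2 * s) • x)‖ ≤ C * Real.exp 2 ^ k * (1 + ‖x‖) ^ (-k : ℝ) := by
    rw [Real.rpow_neg (by positivity), Real.rpow_natCast, ← div_eq_mul_inv, le_div_iff₀ hpos]
    calc ‖φ (Real.exp (-2 * s) • x)‖ * (1 + ‖x‖) ^ k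
        ≤ ‖φ (Real.exp (-2 * s) • x)‖ * (Real.exp 2 * (1 + ‖Real.exp (-2 * s) • x‖)) ^ k := by
          gcongr
      _ = ((1 + ‖Real.exp (-2 * s) • x‖) ^ k * ‖φ (Real.exp (-2 * s) • x)‖) * Real.exp 2 ^ k := by
          rw [mul_pow]
          ring
      _ ≤ C * Real.exp 2 ^ k := by
          gcongr
          exact hC _
  gcongr

/-- `dilation` is the unitary group generated by `A = x · p + p · x`. -/
theorem isUnitaryGroup_dilation : IsUnitaryGroup (dilationGen (n := n)) (dilation n) := by
  refine .of_generator (LinearIsometryEquiv.ext dilate_zero)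
    (fun a b => LinearIsometryEquiv.ext fun f => (dilate_dilate a b f).symm) fun φ => ?_
  have h := hasDerivAt_toLp (B := fun φ : 𝓢(Space n, ℂ) => (-Complex.I) • dilationGen φ)
    hasDerivAt_dilationSchwartz dilationSchwartz_dominated φ
  simp only [dilation_toLp]
  refine h.congr_deriv ?_
  rw [dilationSchwartz_zero, toLp_smul]

/-- Existence of one such group makes the epsilon choice meaningful; invariance of Schwartz
functions under dilations makes it unique. -/
theorem expA_eq_dilation : expA n = dilation n :=
  (Classical.epsilon_spec ⟨_, isUnitaryGroup_dilation⟩ :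
    IsUnitaryGroup dilationGen (expA n)).unique isUnitaryGroup_dilation
      fun β φ => ⟨_, dilation_toLp β φ⟩

theorem momOp_dilationSchwartz (β : ℝ) (j : Fin n) (φ : 𝓢(Space n, ℂ)) :
    momOp j (dilationSchwartz β φ) =
      ((Real.exp (-2 * β) : ℝ) : ℂ) • dilationSchwartz β (momOp j φ) := by
  rw [dilationSchwartz, momOp_smul, dilationSchwartz, smul_comm]
  congr 1
  ext x
  have h1 : HasFDerivAt (fun x : Space n => Real.exp (-2 * β) • x)
      (Real.exp (-2 * β) • ContinuousLinearMap.id ℝ (Space n)) x :=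
    (Real.exp (-2 * β) • ContinuousLinearMap.id ℝ (Space n)).hasFDerivAt
  have h2 := (hasFDerivAt_schwartz φ (Real.exp (-2 * β) • x)).comp x h1
  have h3 : momOp j (compCLMOfContinuousLinearEquiv ℂ (expSmulEquiv n β) φ) x =
      -Complex.I * (fderiv ℝ φ (Real.exp (-2 * β) • x)).comp
        (Real.exp (-2 * β) • ContinuousLinearMap.id ℝ (Space n)) (EuclideanSpace.single j 1) := by
    rw [momOp_apply, ← h2.fderiv]
    rfl
  have h4 : compCLMOfContinuousLinearEquiv ℂ (expSmulEquiv n β) (momOp j φ) x =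
      -Complex.I * fderiv ℝ φ (Real.exp (-2 * β) • x) (EuclideanSpace.single j 1) := rfl
  rw [h3, smul_apply, h4, ContinuousLinearMap.comp_apply, smul_apply,
    map_smul _ (Real.exp (-2 * β)), Complex.real_smul, smul_eq_mul, ContinuousLinearMap.id_apply]
  ring

theorem dilationSchwartz_sum {ι : Type*} (β : ℝ) (s : Finset ι) (f : ι → 𝓢(Space n, ℂ)) :
    dilationSchwartz β (∑ i ∈ s, f i) = ∑ i ∈ s, dilationSchwartz β (f i) := by
  simp only [dilationSchwartz]
  rw [map_sum, Finset.smul_sum]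

/-- Conjugation of the kinetic energy by a dilation. -/
theorem momSq_dilationSchwartz (β : ℝ) (φ : 𝓢(Space n, ℂ)) :
    momSq (dilationSchwartz β φ) =
      ((Real.exp (-4 * β) : ℝ) : ℂ) • dilationSchwartz β (momSq φ) := by
  simp only [momSq, dilationSchwartz_sum, Finset.smul_sum]
  refine Finset.sum_congr rfl fun j _ => ?_
  rw [momOp_dilationSchwartz, momOp_smul, momOp_dilationSchwartz, smul_smul, ← Complex.ofReal_mul,
    ← Real.exp_add]
  congr 3
  ring

end Dilation

/-! ### Multiplication by bounded functions -/

section MulOp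

variable {n : ℕ} {v : Space n → ℝ} {C : ℝ}

theorem memLp_mul_of_bounded (hv : Continuous v) (hC : ∀ x, |v x| ≤ C) (f : L2 n) :
    MemLp (fun x => (v x : ℂ) * f x) 2 (volume : Measure (Space n)) := by
  refine (Lp.memLp f).of_le_mul (c := C) ?_ (Eventually.of_forall fun x => ?_)
  · exact (Continuous.aestronglyMeasurable (by fun_prop)).mul (Lp.aestronglyMeasurable f)
  · rw [norm_mul, Complex.norm_real, Real.norm_eq_abs]
    gcongr
    exact hC x

theorem coeFn_mulOp (hv : Continuous v) (hC : ∀ x, |v x| ≤ C) (f : L2 n) :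
    mulOp v f =ᵐ[volume] fun x => (v x : ℂ) * f x := by
  rw [mulOp, dif_pos (memLp_mul_of_bounded hv hC f)]
  exact (memLp_mul_of_bounded hv hC f).coeFn_toLp

theorem norm_mulOp_le (hv : Continuous v) (hC : ∀ x, |v x| ≤ C) (f : L2 n) :
    ‖mulOp v f‖ ≤ C * ‖f‖ := by
  refine Lp.norm_le_mul_norm_of_ae_le_mul ?_
  filter_upwards [coeFn_mulOp hv hC f] with x h
  rw [h, norm_mul, Complex.norm_real, Real.norm_eq_abs]
  gcongr
  exact hC x

theorem mulOp_zero (f : L2 n) : mulOp (fun _ => 0) f = 0 := by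
  apply Lp.ext
  filter_upwards [coeFn_mulOp (v := fun _ => 0) (C := 0) continuous_const (by simp) f,
    Lp.coeFn_zero ℂ 2 (volume : Measure (Space n))] with x h1 h2
  rw [h1, h2]
  simp

theorem mulOp_phase (hv : Continuous v) (hC : ∀ x, |v x| ≤ C) (c : ℝ) (f : L2 n) :
    mulOp v (phase c f) = phase c (mulOp v f) := by
  apply Lp.ext
  filter_upwards [coeFn_mulOp hv hC (phase c f), coeFn_phase c f, coeFn_phase c (mulOp v f),
    coeFn_mulOp hv hC f] with x h1 h2 h3 h4
  rw [h1, h2, h3, h4]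
  ring

/-- With $\beta=\lambda\log|t|/2$ the factor $e^{2\beta}$ is $|t|^\lambda$, which produces the
potential of $H_S$. -/
theorem mulOp_dilation (hv : Continuous v) (hC : ∀ x, |v x| ≤ C) (β : ℝ) (f : L2 n) :
    mulOp v (dilation n β f) = dilation n β (mulOp (fun x => v (Real.exp (2 * β) • x)) f) := by
  apply Lp.ext
  filter_upwards [coeFn_mulOp hv hC (dilation n β f), coeFn_dilation β f,
    coeFn_dilation β (mulOp (fun x => v (Real.exp (2 * β) • x)) f),
    (quasiMeasurePreserving_exp_smul β).ae (coeFn_mulOp (v := fun x => v (Real.exp (2 * β) • x))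
      (by fun_prop) (fun x => hC _) f)] with x h1 h2 h3 h4
  rw [h1, h2, h3, h4, smul_smul, ← Real.exp_add]
  simp
  ring

/-- Multiplication by a jointly continuous, locally bounded potential is weakly continuous in
time. -/
theorem continuousAt_inner_mulOp {V : ℝ → Space n → ℝ}
    (hV : Continuous fun z : ℝ × Space n => V z.1 z.2) {t : ℝ}
    (hC : ∀ᶠ τ in 𝓝 t, ∀ x, |V τ x| ≤ C) (f : L2 n) {u : ℝ → L2 n} (hu : ContinuousAt u t) :
    ContinuousAt (fun τ => inner ℂ (mulOp (V τ) f) (u τ)) t := by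
  have hVc : ∀ τ, Continuous (V τ) := fun τ => hV.comp (by fun_prop : Continuous fun x => (τ, x))
  have h1 : Tendsto (fun τ => inner ℂ (mulOp (V τ) f) (u τ - u t)) (𝓝 t) (𝓝 0) := by
    have h2 : Tendsto (fun τ => C * ‖f‖ * ‖u τ - u t‖) (𝓝 t) (𝓝 0) := by
      simpa using ((hu.sub_const (u t)).norm.const_mul (C * ‖f‖) :)
    refine squeeze_zero_norm' ?_ h2
    filter_upwards [hC] with τ hτ
    refine (norm_inner_le_norm _ _).trans ?_
    gcongr
    exact norm_mulOp_le (hVc τ) hτ f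
  -- Against a fixed vector, dominated convergence needs only pointwise continuity of $V$ in time,
  -- with no uniformity in $x$.
  have h3 : Tendsto (fun τ => inner ℂ (mulOp (V τ) f) (u t)) (𝓝 t)
      (𝓝 (inner ℂ (mulOp (V t) f) (u t))) := by
    have h4 : ∀ τ, (∀ x, |V τ x| ≤ C) → inner ℂ (mulOp (V τ) f) (u t) =
        ∫ x, (V τ x : ℂ) * inner ℂ (f x) (u t x) := by
      intro τ hτ
      rw [L2.inner_def]
      refine integral_congr_ae ?_
      filter_upwards [coeFn_mulOp (hVc τ) hτ f] with x hx
      rw [hx, ← smul_eq_mul, inner_smul_left, Complex.conj_ofReal]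
    have h5 : Tendsto (fun τ => ∫ x, (V τ x : ℂ) * inner ℂ (f x) (u t x)) (𝓝 t)
        (𝓝 (∫ x, (V t x : ℂ) * inner ℂ (f x) (u t x))) := by
      have hint := L2.integrable_inner (𝕜 := ℂ) f (u t)
      refine tendsto_integral_filter_of_dominated_convergence
        (fun x => C * ‖inner ℂ (f x) (u t x)‖) ?_ ?_ (hint.norm.const_mul C) ?_
      · refine Eventually.of_forall fun τ => ?_
        have := hVc τ
        exact (Continuous.aestronglyMeasurable (by fun_prop)).mul hint.aestronglyMeasurable
      · filter_upwards [hC] with τ hτ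
        refine Eventually.of_forall fun x => ?_
        rw [norm_mul, Complex.norm_real, Real.norm_eq_abs]
        gcongr
        exact hτ x
      · refine Eventually.of_forall fun x => ?_
        have h6 : Continuous fun τ => (V τ x : ℂ) * inner ℂ (f x) (u t x) :=
          (Complex.continuous_ofReal.comp
            (hV.comp (by fun_prop : Continuous fun τ => (τ, x)))).mul continuous_const
        exact h6.tendsto t
    rw [h4 t hC.self_of_nhds]
    refine h5.congr' ?_
    filter_upwards [hC] with τ hτ
    rw [h4 τ hτ]
  have h6 := h1.add h3
  simp only [← inner_add_right, sub_add_cancel, zero_add] at h6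
  exact h6

end MulOp

/-! ### Weak solutions in the interaction picture -/

section Weak

variable {n : ℕ}

theorem IsUnitaryGroup.continuousOn_apply {B : 𝓢(Space n, ℂ) → 𝓢(Space n, ℂ)} {W : ℝ → Unitary n}
    (hW : IsUnitaryGroup B W) {a : ℝ → ℝ} {y : ℝ → L2 n} {s : Set ℝ} (ha : ContinuousOn a s)
    (hy : ContinuousOn y s) : ContinuousOn (fun t => W (a t) (y t)) s := fun t ht =>
  tendsto_unitary_apply (W := fun t => W (a t))
    (((hW.continuous (y t)).tendsto (a t)).comp (ha t ht)) (hy t ht)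

theorem IsUnitaryGroup.apply_neg_apply {B : 𝓢(Space n, ℂ) → 𝓢(Space n, ℂ)} {W : ℝ → Unitary n}
    (hW : IsUnitaryGroup B W) (β : ℝ) (f : L2 n) : W β (W (-β) f) = f := by
  have h := hW.add β (-β)
  rw [add_neg_cancel, hW.zero] at h
  exact (congrArg (fun U : Unitary n => U f) h).symm

theorem IsUnitaryGroup.inner_neg_right {B : 𝓢(Space n, ℂ) → 𝓢(Space n, ℂ)} {W : ℝ → Unitary n}
    (hW : IsUnitaryGroup B W) (β : ℝ) (f g : L2 n) :
    inner ℂ f (W (-β) g) = inner ℂ (W β f) g := by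
  rw [← LinearIsometryEquiv.inner_map_map (W β), hW.apply_neg_apply]

/-- The product rule with the generator applied last: `t ↦ W(a(t)) y(t)` is differentiable where its
value is a Schwartz function. -/
theorem IsUnitaryGroup.hasDerivAt_apply' {B : 𝓢(Space n, ℂ) → 𝓢(Space n, ℂ)} {W : ℝ → Unitary n}
    (hW : IsUnitaryGroup B W) {a : ℝ → ℝ} {a' : ℝ} {y : ℝ → L2 n} {y' : L2 n} {t : ℝ}
    {χ : 𝓢(Space n, ℂ)} (ha : HasDerivAt a a' t) (hy : HasDerivAt y y' t)
    (hχ : W (a t) (y t) = χ.toLp 2 volume) :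
    HasDerivAt (fun s => W (a s) (y s))
      ((a' : ℂ) • (-Complex.I) • (B χ).toLp 2 volume + W (a t) y') t := by
  have h1 : HasDerivAt (fun s => W (a t) (y s)) (W (a t) y') t :=
    ((W (a t) : L2 n ≃L[ℂ] L2 n).toContinuousLinearMap.restrictScalars
      ℝ).hasFDerivAt.comp_hasDerivAt t hy
  have h2 := hW.hasDerivAt_apply (ha.sub_const (a t)) h1 hχ
  rw [sub_self, hW.zero] at h2
  refine h2.congr_of_eventuallyEq (Eventually.of_forall fun s => ?_)
  have h3 := hW.add (a s - a t) (a t)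
  rw [sub_add_cancel] at h3
  simp only [h3]
  rfl

/-- Differentiation of a propagator against a differentiable family of vectors. -/
theorem IsPropagatorOn.hasDerivAt_inner {I O : Set ℝ} {H : ℝ → 𝓢(Space n, ℂ) → L2 n}
    {U : ℝ → ℝ → Unitary n} (hU : IsPropagatorOn I H U) (hO : IsOpen O) (hconn : O.OrdConnected)
    (hOI : O ⊆ I) {s : ℝ} (hs : s ∈ I) {ψ : L2 n} {t : ℝ} (ht : t ∈ O) {φ : 𝓢(Space n, ℂ)}
    (hc : ContinuousOn (fun τ => inner ℂ (H τ φ) (U τ s ψ)) O) {T : ℝ → L2 n} {T' : L2 n}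
    (hT : HasDerivAt T T' t) (hTt : T t = φ.toLp 2 volume) :
    HasDerivAt (fun τ => inner ℂ (T τ) (U τ s ψ))
      (inner ℂ T' (U t s ψ) - Complex.I * inner ℂ (H t φ) (U t s ψ)) t := by
  have hu : ContinuousOn (fun τ => U τ s ψ) I :=
    (hU.continuousOn ψ).comp (f := fun τ => (τ, s)) (by fun_prop) fun τ hτ => ⟨hτ, hs⟩
  have hut : ContinuousAt (fun τ => U τ s ψ) t := (hu.mono hOI).continuousAt (hO.mem_nhds ht)
  -- The weak equation applies to a fixed Schwartz test vector, so `T τ` is split into `T t` and an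
  -- increment. The increment vanishes at `t`, so continuity of the orbit is enough for it.
  have h1 : HasDerivAt (fun τ => inner ℂ (T τ - T t) (U τ s ψ)) (inner ℂ T' (U t s ψ)) t := by
    rw [hasDerivAt_iff_tendsto_slope] at hT ⊢
    refine (hT.inner (𝕜 := ℂ) (hut.tendsto.mono_left nhdsWithin_le_nhds)).congr fun τ => ?_
    simp only [slope, vsub_eq_sub, sub_self, inner_zero_left, sub_zero]
    rw [RCLike.real_smul_eq_coe_smul (K := ℂ), inner_smul_left, Complex.real_smul]
    simp
  have h2 : HasDerivAt (fun τ => ∫ r in t..τ, inner ℂ (H r φ) (U r s ψ))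
      (inner ℂ (H t φ) (U t s ψ)) t :=
    intervalIntegral.integral_hasDerivAt_right (by simp) (hc.stronglyMeasurableAtFilter hO t ht)
      (hc.continuousAt (hO.mem_nhds ht))
  have h3 : HasDerivAt (fun τ => inner ℂ (T t) (U τ s ψ))
      (-Complex.I * inner ℂ (H t φ) (U t s ψ)) t := by
    refine ((h2.const_mul (-Complex.I)).add_const (inner ℂ (T t) (U t s ψ))).congr_of_eventuallyEq ?_
    filter_upwards [hO.mem_nhds ht] with τ hτ
    have h4 := (hU.forward τ (hOI hτ) t (hOI ht) φ (U t s ψ)).2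
    have h5 : ∀ r ∈ I, U r t (U t s ψ) = U r s ψ := fun r hr => by
      rw [← hU.comp r hr t (hOI ht) s hs]
      rfl
    have h6 : ∫ r in t..τ, inner ℂ (H r φ) (U r t (U t s ψ)) =
        ∫ r in t..τ, inner ℂ (H r φ) (U r s ψ) :=
      intervalIntegral.integral_congr fun r hr => by
        simp only [h5 r (hOI (hconn.uIcc_subset ht hτ hr))]
    rw [h5 τ (hOI hτ), h6, ← hTt] at h4
    rw [← h4]
    linear_combination (inner ℂ (T t) (U τ s ψ) - inner ℂ (T t) (U t s ψ)) * Complex.I_sq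
  refine ((h1.add h3).congr_of_eventuallyEq (Eventually.of_forall fun τ => ?_)).congr_deriv
    (by ring)
  simp only [Pi.add_apply]
  rw [← inner_add_left, sub_add_cancel]

/-- If the test vectors solve the Schrödinger equation for `H₀(t)`, then only the perturbation
contributes to the derivative. -/
theorem IsPropagatorOn.hasDerivAt_inner_interaction {I O : Set ℝ}
    {H₀ : ℝ → 𝓢(Space n, ℂ) → L2 n} {V : ℝ → Space n → ℝ} {U : ℝ → ℝ → Unitary n}
    (hU : IsPropagatorOn I (fun t φ => H₀ t φ + mulOp (V t) (φ.toLp 2 volume)) U) (hO : IsOpen O)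
    (hconn : O.OrdConnected) (hOI : O ⊆ I) {s : ℝ} (hs : s ∈ I) {ψ : L2 n} {t : ℝ} (ht : t ∈ O)
    (hH₀ : ∀ φ, ContinuousOn (fun τ => H₀ τ φ) O)
    (hV : Continuous fun z : ℝ × Space n => V z.1 z.2)
    (hVb : ∀ T : ℝ, ∃ C : ℝ, ∀ t : ℝ, |t| ≤ T → ∀ x : Space n, |V t x| ≤ C)
    {φ : 𝓢(Space n, ℂ)} {T : ℝ → L2 n} (hT : HasDerivAt T ((-Complex.I) • H₀ t φ) t)
    (hTt : T t = φ.toLp 2 volume) :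
    HasDerivAt (fun τ => inner ℂ (T τ) (U τ s ψ))
      (-Complex.I * inner ℂ (mulOp (V t) (T t)) (U t s ψ)) t := by
  have hu : ContinuousOn (fun τ => U τ s ψ) I :=
    (hU.continuousOn ψ).comp (f := fun τ => (τ, s)) (by fun_prop) fun τ hτ => ⟨hτ, hs⟩
  have hut : ∀ r ∈ O, ContinuousAt (fun τ => U τ s ψ) r := fun r hr =>
    (hu.mono hOI).continuousAt (hO.mem_nhds hr)
  refine (hU.hasDerivAt_inner hO hconn hOI hs (ψ := ψ) ht ?_ hT hTt).congr_deriv ?_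
  · intro r hr
    obtain ⟨C, hC⟩ := hVb (|r| + 1)
    have h1 : ∀ᶠ τ in 𝓝 r, ∀ x, |V τ x| ≤ C := by
      filter_upwards [continuous_abs.continuousAt.eventually_lt
        (continuousAt_const (y := |r| + 1)) (lt_add_one |r|)] with τ hτ
      exact hC τ hτ.le
    have h2 := continuousAt_inner_mulOp hV h1 (φ.toLp 2 volume) (hut r hr)
    have h3 := ContinuousAt.inner (𝕜 := ℂ) ((hH₀ φ).continuousAt (hO.mem_nhds hr)) (hut r hr)
    simp only [inner_add_left]
    exact (h3.add h2).continuousWithinAt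
  · rw [inner_add_left, inner_smul_left, hTt]
    simp
    ring

end Weak

/-! ### The exponent `λ` -/

section Exponent

variable {m k : ℝ}

theorem lam_nonneg (hm : 0 < m) (hk : 0 ≤ k) : 0 ≤ lam m k := by
  have : Real.sqrt (1 - 4 * k / m) ≤ 1 := by
    refine Real.sqrt_le_iff.2 ⟨zero_le_one, ?_⟩
    have : 0 ≤ 4 * k / m := by positivity
    linarith
  unfold lam
  linarith

theorem one_sub_four_mul_div_pos (hm : 0 < m) (hkm : k < m / 4) : 0 < 1 - 4 * k / m := by
  rw [sub_pos, div_lt_one hm]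
  linarith

theorem two_mul_lam_lt_one (hm : 0 < m) (hkm : k < m / 4) : 2 * lam m k < 1 := by
  have := Real.sqrt_pos.2 (one_sub_four_mul_div_pos hm hkm)
  unfold lam
  linarith

theorem lam_eq (hm : 0 < m) (hkm : k < m / 4) : m * lam m k = m * lam m k ^ 2 + k := by
  have h := Real.sq_sqrt (one_sub_four_mul_div_pos hm hkm).le
  have h2 : m * (1 - 4 * k / m) = m - 4 * k := by
    field_simp
  unfold lam
  linear_combination (-m / 4) * h - h2 / 4

end Exponent

/-! ### Explicit solutions of the free equations -/

section Explicit

variable {n : ℕ} {m k : ℝ}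

theorem exp_mul_log_abs (r : ℝ) {t : ℝ} (ht : t ≠ 0) :
    Real.exp (r * Real.log |t|) = |t| ^ r := by
  rw [Real.rpow_def_of_pos (abs_pos.2 ht), mul_comm]

theorem posSq_phaseSchwartz (c : ℝ) (φ : 𝓢(Space n, ℂ)) :
    posSq (phaseSchwartz c φ) = phaseSchwartz c (posSq φ) := by
  ext x
  rw [posSq_apply, phaseSchwartz_apply, phaseSchwartz_apply, posSq_apply]
  ring

/-- The reduced free Hamiltonians at different times are multiples of $p^2$, so the evolution is the
group of $p^2$ run with the clock `c`. -/
theorem hasDerivAt_freeGroup {lam t : ℝ} {c : ℝ → ℝ}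
    (hc : HasDerivAt c (1 / (2 * m * |t| ^ (2 * lam))) t) (φ : 𝓢(Space n, ℂ)) :
    HasDerivAt (fun τ => freeGroup n (c τ) (φ.toLp 2 volume))
      ((-Complex.I) • reducedFreeHam m lam t (freeSchwartz (c t) φ)) t := by
  refine (isUnitaryGroup_freeGroup.hasDerivAt_apply' hc (hasDerivAt_const t (φ.toLp 2 volume))
    (freeGroup_toLp (c t) φ)).congr_deriv ?_
  rw [map_zero, add_zero, reducedFreeHam, toLp_smul, smul_comm]

/-- The intertwining operator turns a free reduced evolution into a solution of the Schrödinger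
equation with the oscillator term `k t⁻² x² / 2`. -/
theorem hasDerivAt_oscillator {lam t : ℝ} (hm : m ≠ 0) (ht : t ≠ 0)
    (hlam : m * lam = m * lam ^ 2 + k) {c : ℝ → ℝ}
    (hc : HasDerivAt c (1 / (2 * m * |t| ^ (2 * lam))) t) (φ : 𝓢(Space n, ℂ)) :
    HasDerivAt (fun τ => phase (m * lam / (2 * τ)) (dilation n (lam * Real.log |τ| / 2)
        (freeGroup n (c τ) (φ.toLp 2 volume))))
      ((-Complex.I) • freeHam m (fun τ => k / τ ^ 2) t (phaseSchwartz (m * lam / (2 * t))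
        (dilationSchwartz (lam * Real.log |t| / 2) (freeSchwartz (c t) φ)))) t := by
  set g := freeSchwartz (c t) φ
  set h := dilationSchwartz (lam * Real.log |t| / 2) g with hh
  set a := m * lam / (2 * t) with ha
  -- This rate equals the coefficient $2a/(2m)$ of $A$ in the gauge-transformed kinetic energy.
  have hb' : HasDerivAt (fun τ => lam * Real.log |τ| / 2) (a / m) t := by
    simp only [Real.log_abs]
    refine (((Real.hasDerivAt_log ht).const_mul lam).div_const 2).congr_deriv ?_
    rw [ha]
    field_simp
  -- The quadratic equation for $\lambda$ in the form of a Riccati equation for the phase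
  -- coefficient `a`.
  have ha' : HasDerivAt (fun τ => m * lam / (2 * τ)) (-(4 * a ^ 2 / (2 * m) + k / t ^ 2 / 2)) t := by
    refine ((hasDerivAt_const t (m * lam)).div ((hasDerivAt_id t).const_mul 2)
      (by simpa using ht)).congr_deriv ?_
    rw [ha]
    simp only [id]
    field_simp
    linear_combination (-4) * hlam
  have h1 := hasDerivAt_freeGroup hc φ
  have hD : dilation n (lam * Real.log |t| / 2) (freeGroup n (c t) (φ.toLp 2 volume)) =
      h.toLp 2 volume := by
    rw [freeGroup_toLp, dilation_toLp]
  have h2 := isUnitaryGroup_dilation.hasDerivAt_apply' hb' h1 hD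
  have hP : phase a (dilation n (lam * Real.log |t| / 2) (freeGroup n (c t) (φ.toLp 2 volume))) =
      (phaseSchwartz a h).toLp 2 volume := by
    rw [hD, phase_toLp]
  refine (isUnitaryGroup_phase.hasDerivAt_apply' ha' h2 hP).congr_deriv ?_
  have hM : dilationSchwartz (lam * Real.log |t| / 2) (momSq g) =
      ((|t| ^ (2 * lam) : ℝ) : ℂ) • momSq h := by
    rw [hh, momSq_dilationSchwartz, smul_smul, ← exp_mul_log_abs _ ht, ← Complex.ofReal_mul,
      ← Real.exp_add]
    ring_nf
    simp
  have hpow : ((1 / (2 * m * |t| ^ (2 * lam)) : ℝ) : ℂ) * ((|t| ^ (2 * lam) : ℝ) : ℂ) =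
      ((1 / (2 * m) : ℝ) : ℂ) := by
    rw [← Complex.ofReal_mul]
    have := (Real.rpow_pos_of_pos (abs_pos.2 ht) (2 * lam)).ne'
    congr 1
    field_simp
  rw [reducedFreeHam, map_smul, dilation_toLp, dilationSchwartz_smul, hM, smul_smul _ _ (momSq h),
    hpow, freeHam]
  simp only [← toLp_smul, ← toLp_add, phase_toLp]
  congr 1
  rw [momSq_phaseSchwartz, posSq_phaseSchwartz]
  simp only [map_add, map_smul]
  have hmc : (m : ℂ) ≠ 0 := by exact_mod_cast hm
  match_scalars <;> field_simp

end Explicit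

/-! ### Uniqueness -/

/-- Grönwall's inequality in integral form, with vanishing initial value. -/
theorem eq_zero_of_le_mul_integral {N : ℝ → ℝ} {a b C : ℝ} (hab : a ≤ b)
    (hN : ContinuousOn N (Set.Icc a b)) (hN0 : ∀ s ∈ Set.Icc a b, 0 ≤ N s)
    (hle : ∀ s ∈ Set.Icc a b, N s ≤ C * ∫ r in a..s, N r) : N b = 0 := by
  -- The continuous extension by endpoint values makes the primitive differentiable everywhere.
  -- Grönwall is applied to this primitive, which vanishes at `a`.
  set N' : ℝ → ℝ := Set.IccExtend hab (Set.domRestrict (Set.Icc a b) N) with hN'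
  have hc : Continuous N' := hN.domRestrict.Icc_extend'
  have heq : ∀ s ∈ Set.Icc a b, N' s = N s := fun s hs => by
    rw [hN', Set.IccExtend_of_mem hab _ hs]
    rfl
  have hM : ∀ s, HasDerivAt (fun s => ∫ r in a..s, N' r) (N' s) s := fun s =>
    intervalIntegral.integral_hasDerivAt_right (hc.intervalIntegrable _ _)
      hc.stronglyMeasurable.stronglyMeasurableAtFilter hc.continuousAt
  have hint : ∀ s ∈ Set.Icc a b, ∫ r in a..s, N r = ∫ r in a..s, N' r := fun s hs =>
    intervalIntegral.integral_congr fun r hr => by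
      rw [Set.uIcc_of_le hs.1] at hr
      exact (heq r ⟨hr.1, hr.2.trans hs.2⟩).symm
  have hg := norm_le_gronwallBound_of_norm_deriv_right_le (δ := 0) (K := |C|) (ε := 0)
    (f := fun s => ∫ r in a..s, N' r) (f' := N') (a := a) (b := b)
    (fun s _ => (hM s).continuousAt.continuousWithinAt) (fun s _ => (hM s).hasDerivWithinAt)
    (by simp) (fun s hs => by
      have hs' := Set.Ico_subset_Icc_self hs
      rw [heq s hs', Real.norm_eq_abs, abs_of_nonneg (hN0 s hs'), add_zero, Real.norm_eq_abs,
        ← abs_mul, ← hint s hs']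
      exact (hle s hs').trans (le_abs_self _)) b ⟨hab, le_rfl⟩
  rw [gronwallBound_ε0_δ0, norm_le_zero_iff] at hg
  have h1 := hle b ⟨hab, le_rfl⟩
  rw [hint b ⟨hab, le_rfl⟩, hg, mul_zero] at h1
  exact h1.antisymm (hN0 b ⟨hab, le_rfl⟩)

/-- By density the bound holds for every test vector, in particular for `f` itself. -/
theorem norm_le_of_inner_schwartz_le {n : ℕ} {f : L2 n} {K : ℝ} (hK : 0 ≤ K)
    (h : ∀ φ : 𝓢(Space n, ℂ), ‖inner ℂ (φ.toLp 2 volume) f‖ ≤ K * ‖φ.toLp 2 volume‖) :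
    ‖f‖ ≤ K := by
  have h1 : ∀ g : L2 n, ‖inner ℂ g f‖ ≤ K * ‖g‖ := fun g =>
    (dense_range_toLp n).induction_on g (isClosed_le (by fun_prop) (by fun_prop)) h
  have h2 := h1 f
  rcases (norm_nonneg f).eq_or_lt with h0 | h0
  · rwa [← h0]
  · rw [inner_self_eq_norm_sq_to_K, norm_pow, RCLike.norm_ofReal, abs_norm, pow_two] at h2
    exact le_of_mul_le_mul_right h2 h0

/-- A primitive of `1 / (2 m |t|^{2λ})` on the half-line of sign `σ`. -/
theorem hasDerivAt_clock {m lam σ t : ℝ} (hm : m ≠ 0) (hlam : 2 * lam < 1) (hσ : σ = 1 ∨ σ = -1)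
    (ht : 0 < σ * t) :
    HasDerivAt (fun τ => σ * (σ * τ) ^ (1 - 2 * lam) / (2 * m * (1 - 2 * lam)))
      (1 / (2 * m * |t| ^ (2 * lam))) t := by
  have hσ2 : σ * σ = 1 := by rcases hσ with rfl | rfl <;> norm_num
  have habs : |t| = σ * t := by
    rcases hσ with rfl | rfl
    · rw [one_mul] at ht ⊢
      exact abs_of_pos ht
    · rw [neg_one_mul] at ht ⊢
      exact abs_of_neg (neg_pos.1 ht)
  have h1 : HasDerivAt (fun τ => σ * τ) σ t := by simpa using (hasDerivAt_id t).const_mul σ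
  have h2 := ((h1.rpow_const (p := 1 - 2 * lam) (Or.inl ht.ne')).const_mul σ).div_const
    (2 * m * (1 - 2 * lam))
  refine h2.congr_deriv ?_
  -- The strict inequality $2\lambda<1$ excludes a logarithmic primitive.
  have h3 : (1 - 2 * lam) ≠ 0 := by linarith
  have h4 := (Real.rpow_pos_of_pos ht (2 * lam)).ne'
  rw [habs, show 1 - 2 * lam - 1 = -(2 * lam) by ring, Real.rpow_neg ht.le]
  field_simp
  linear_combination hσ2

/-! ### The intertwining relation -/

section Main

variable {n : ℕ} {m r₀ k : ℝ} {kC : ℝ → ℝ}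

/-- The intertwining relation, on a vector. -/
theorem propagator_apply_eq (hm : 0 < m) (hr₀ : 0 < r₀) (hk : 0 ≤ k) (hkm : k < m / 4) {σ : ℝ}
    (hσ : σ = 1 ∨ σ = -1) {V : ℝ → Space n → ℝ}
    (hV : Continuous fun z : ℝ × Space n => V z.1 z.2)
    (hVb : ∀ T : ℝ, ∃ C : ℝ, ∀ t : ℝ, |t| ≤ T → ∀ x : Space n, |V t x| ≤ C)
    {U US : ℝ → ℝ → Unitary n}
    (hU : IsPropagatorOn Set.univ (ham m (coeff r₀ k kC) V) U)
    (hUS : IsPropagatorOn {τ : ℝ | r₀ ≤ σ * τ} (reducedHam m (lam m k) V) US) {t : ℝ}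
    (ht : r₀ ≤ σ * t) (ψ : L2 n) :
    U t (σ * r₀) (phase (m * lam m k / (2 * (σ * r₀)))
        (dilation n (lam m k * Real.log r₀ / 2) ψ)) =
      phase (m * lam m k / (2 * t)) (dilation n (lam m k * Real.log |t| / 2)
        (US t (σ * r₀) ψ)) := by
  set l := lam m k with hl
  have hl0 : 0 ≤ l := lam_nonneg hm hk
  have hσ2 : σ * σ = 1 := by rcases hσ with rfl | rfl <;> norm_num
  have habsσ : |σ| = 1 := by rcases hσ with rfl | rfl <;> norm_num
  have habs : ∀ s, |σ * s| = |s| := fun s => by rw [abs_mul, habsσ, one_mul]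
  set I : Set ℝ := {τ : ℝ | r₀ ≤ σ * τ} with hI
  -- At $|\tau|=r_0$ the coefficient is still `kC`, so equations are differentiated only on this
  -- open ray. The endpoint is reached by continuity.
  set O : Set ℝ := {τ : ℝ | r₀ < σ * τ} with hO
  have hOopen : IsOpen O := isOpen_lt continuous_const (by fun_prop)
  have hOI : O ⊆ I := fun τ (hτ : r₀ < σ * τ) => hτ.le
  have hOconn : O.OrdConnected := by
    refine ⟨fun x hx y hy z hz => ?_⟩
    simp only [hO, Set.mem_ofPred_eq] at hx hy ⊢
    rcases hσ with rfl | rfl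
    · linarith [hz.1]
    · linarith [hz.2]
  have hne : ∀ τ ∈ I, τ ≠ 0 := fun τ hτ h0 => by
    simp only [hI, Set.mem_ofPred_eq, h0, mul_zero] at hτ
    linarith
  have hs0 : σ * r₀ ∈ I := by
    simp only [hI, Set.mem_ofPred_eq, ← mul_assoc, hσ2, one_mul, le_refl]
  set c : ℝ → ℝ := fun τ => σ * (σ * τ) ^ (1 - 2 * l) / (2 * m * (1 - 2 * l)) with hc
  have hc' : ∀ τ ∈ I, HasDerivAt c (1 / (2 * m * |τ| ^ (2 * l))) τ := fun τ hτ =>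
    hasDerivAt_clock hm.ne' (two_mul_lam_lt_one hm hkm) hσ (hr₀.trans_le hτ)
  -- the reduced potential
  set VS : ℝ → Space n → ℝ := fun τ x => V τ ((|τ| ^ l) • x) with hVS
  have hVSc : Continuous fun z : ℝ × Space n => VS z.1 z.2 := by
    have h1 : Continuous fun z : ℝ × Space n => |z.1| ^ l :=
      (continuous_abs.comp continuous_fst).rpow_const fun _ => Or.inr hl0
    exact hV.comp (continuous_fst.prodMk (h1.smul continuous_snd))
  have hVSb : ∀ T : ℝ, ∃ C : ℝ, ∀ t : ℝ, |t| ≤ T → ∀ x : Space n, |VS t x| ≤ C := fun T => by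
    obtain ⟨C, hC⟩ := hVb T
    exact ⟨C, fun t ht x => hC t ht _⟩
  set ψ' := phase (m * l / (2 * (σ * r₀))) (dilation n (l * Real.log r₀ / 2) ψ) with hψ'
  set u₁ : ℝ → L2 n := fun τ => U τ (σ * r₀) ψ' with hu₁
  set u₂ : ℝ → L2 n := fun τ => US τ (σ * r₀) ψ with hu₂
  have hu₁c : ContinuousOn u₁ I :=
    (hU.continuousOn ψ').comp (f := fun τ => (τ, σ * r₀)) (by fun_prop) fun τ _ => ⟨trivial, trivial⟩
  have hu₂c : ContinuousOn u₂ I :=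
    (hUS.continuousOn ψ).comp (f := fun τ => (τ, σ * r₀)) (by fun_prop) fun τ hτ => ⟨hτ, hs0⟩
  set w : ℝ → L2 n := fun τ => dilation n (-(l * Real.log |τ| / 2))
    (phase (-(m * l / (2 * τ))) (u₁ τ)) - u₂ τ with hw
  have hlog : ContinuousOn (fun τ : ℝ => -(l * Real.log |τ| / 2)) I := by
    have : ContinuousOn (fun τ : ℝ => Real.log |τ|) I :=
      continuous_abs.continuousOn.log fun τ hτ => abs_ne_zero.2 (hne τ hτ)
    fun_prop
  have hwc : ContinuousOn w I := by
    refine (isUnitaryGroup_dilation.continuousOn_apply hlog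
      (isUnitaryGroup_phase.continuousOn_apply ?_ hu₁c)).sub hu₂c
    exact (continuousOn_const.div (by fun_prop) fun τ hτ => by simpa using hne τ hτ).neg
  have hw0 : w (σ * r₀) = 0 := by
    simp only [hw, hu₁, hu₂, hU.self _ trivial, hUS.self _ hs0, hψ', LinearIsometryEquiv.coe_one,
      id, habs, abs_of_pos hr₀]
    have h1 := isUnitaryGroup_phase.apply_neg_apply (-(m * l / (2 * (σ * r₀))))
      (dilation n (l * Real.log r₀ / 2) ψ)
    have h2 := isUnitaryGroup_dilation.apply_neg_apply (-(l * Real.log r₀ / 2)) ψ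
    rw [neg_neg] at h1 h2
    rw [h1, h2, sub_self]
  obtain ⟨C, hC⟩ := hVSb |t|
  -- evolution of the difference in the interaction picture
  have hderiv : ∀ φ : 𝓢(Space n, ℂ), ∀ τ ∈ O,
      HasDerivAt (fun τ => inner ℂ (freeGroup n (c τ) (φ.toLp 2 volume)) (w τ))
        (-Complex.I * inner ℂ (mulOp (VS τ) (freeGroup n (c τ) (φ.toLp 2 volume))) (w τ)) τ := by
    intro φ τ hτ
    have hτI := hOI hτ
    have hτ0 := hne τ hτI
    have hcoeff : ∀ r ∈ O, coeff r₀ k kC r = k / r ^ 2 := fun r (hr : r₀ < σ * r) => by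
      rw [coeff, if_neg]
      rw [← habs, not_le]
      exact hr.trans_le (le_abs_self _)
    have hfree : ∀ r ∈ O, ∀ χ : 𝓢(Space n, ℂ), freeHam m (coeff r₀ k kC) r χ =
        freeHam m (fun r => k / r ^ 2) r χ := fun r hr χ => by
      simp only [freeHam, hcoeff r hr]
    have hc₁ : ∀ χ : 𝓢(Space n, ℂ),
        ContinuousOn (fun r => freeHam m (coeff r₀ k kC) r χ) O := by
      intro χ
      have h1 : ContinuousOn (fun r : ℝ => ((k / r ^ 2 / 2 : ℝ) : ℂ)) O :=
        Complex.continuous_ofReal.comp_continuousOn ((continuousOn_const.div (by fun_prop)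
          fun r hr => pow_ne_zero 2 (hne r (hOI hr))).div_const 2)
      refine ContinuousOn.congr (f := fun r => ((1 / (2 * m) : ℝ) : ℂ) • (momSq χ).toLp 2 volume +
        ((k / r ^ 2 / 2 : ℝ) : ℂ) • (posSq χ).toLp 2 volume) (by fun_prop) fun r hr => ?_
      simp only [freeHam, toLp_add, toLp_smul, hcoeff r hr]
    have hc₂ : ∀ χ : 𝓢(Space n, ℂ), ContinuousOn (fun r => reducedFreeHam m l r χ) O := by
      intro χ
      have h1 : ContinuousOn (fun r : ℝ => ((1 / (2 * m * |r| ^ (2 * l)) : ℝ) : ℂ)) O := by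
        refine Complex.continuous_ofReal.comp_continuousOn (continuousOn_const.div ?_ ?_)
        · exact continuousOn_const.mul (continuous_abs.continuousOn.rpow_const fun r hr =>
            Or.inl (abs_ne_zero.2 (hne r (hOI hr))))
        · intro r hr
          have := Real.rpow_pos_of_pos (abs_pos.2 (hne r (hOI hr))) (2 * l)
          positivity
      simp only [reducedFreeHam, toLp_smul]
      fun_prop
    have hT₁ := hasDerivAt_oscillator hm.ne' hτ0 (lam_eq hm hkm) (hc' τ hτI) φ
    rw [← hfree τ hτ] at hT₁
    have hT₂ := hasDerivAt_freeGroup (hc' τ hτI) φ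
    have h₁ := hU.hasDerivAt_inner_interaction hOopen hOconn (Set.subset_univ O)
      (Set.mem_univ (σ * r₀)) (ψ := ψ') hτ hc₁ hV hVb hT₁
      (by rw [freeGroup_toLp, dilation_toLp, phase_toLp])
    have h₂ := hUS.hasDerivAt_inner_interaction hOopen hOconn hOI hs0 (ψ := ψ) hτ hc₂ hVSc hVSb hT₂
      (freeGroup_toLp _ _)
    -- Unitarity moves $J(r)^{-1}$ onto the test vector, so that `f = freeGroup n (c r) φ` becomes
    -- the oscillator solution paired with `u₁`.
    have hpull : ∀ (r : ℝ) (f : L2 n), inner ℂ f (w r) =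
        inner ℂ (phase (m * l / (2 * r)) (dilation n (l * Real.log |r| / 2) f)) (u₁ r) -
          inner ℂ f (u₂ r) := fun r f => by
      rw [hw, inner_sub_right, isUnitaryGroup_dilation.inner_neg_right,
        isUnitaryGroup_phase.inner_neg_right]
    have hVτ : Continuous (V τ) := hV.comp (by fun_prop : Continuous fun x => (τ, x))
    obtain ⟨C', hC'⟩ := hVb |τ|
    refine ((h₁.sub h₂).congr_of_eventuallyEq (Eventually.of_forall fun r =>
      hpull r _)).congr_deriv ?_
    rw [hpull τ, mulOp_phase hVτ (hC' τ le_rfl), mulOp_dilation hVτ (hC' τ le_rfl), mul_sub]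
    have h3 : (fun x => V τ (Real.exp (2 * (l * Real.log |τ| / 2)) • x)) = VS τ := by
      rw [show 2 * (l * Real.log |τ| / 2) = l * Real.log |τ| by ring, exp_mul_log_abs _ hτ0]
    rw [h3]
  have hmem : ∀ s ∈ Set.Icc r₀ (σ * t), σ * s ∈ I := fun s hs => by
    simp only [hI, Set.mem_ofPred_eq, ← mul_assoc, hσ2, one_mul]
    exact hs.1
  -- The substitution of `σ * s` for time turns both half-lines into the increasing interval
  -- $[r_0,\sigma t]$.
  have hwσ : ContinuousOn (fun s => w (σ * s)) (Set.Icc r₀ (σ * t)) :=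
    hwc.comp (by fun_prop) hmem
  have hcσ : ContinuousOn (fun s => c (σ * s)) (Set.Icc r₀ (σ * t)) := fun s hs =>
    ContinuousAt.comp_continuousWithinAt (f := fun s => σ * s) (g := c)
      (hc' _ (hmem s hs)).continuousAt (by fun_prop)
  have hbound : ∀ s ∈ Set.Icc r₀ (σ * t),
      ‖w (σ * s)‖ ≤ |C| * ∫ r in r₀..s, ‖w (σ * r)‖ := by
    intro s hs
    have hsub : Set.Icc r₀ s ⊆ Set.Icc r₀ (σ * t) := Set.Icc_subset_Icc_right hs.2
    have hint : IntervalIntegrable (fun r => ‖w (σ * r)‖) volume r₀ s :=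
      ContinuousOn.intervalIntegrable (by
        rw [Set.uIcc_of_le hs.1]
        exact (hwσ.mono hsub).norm)
    -- Passing to the interaction picture preserves the norm and turns fixed Schwartz test vectors
    -- into the moving ones of `hderiv`.
    rw [← LinearIsometryEquiv.norm_map (freeGroup n (-c (σ * s)))]
    refine norm_le_of_inner_schwartz_le (mul_nonneg (abs_nonneg _)
      (intervalIntegral.integral_nonneg hs.1 fun _ _ => norm_nonneg _)) fun φ => ?_
    rw [isUnitaryGroup_freeGroup.inner_neg_right]
    set f : ℝ → ℂ := fun r => inner ℂ (freeGroup n (c (σ * r)) (φ.toLp 2 volume)) (w (σ * r)) with hf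
    have hfc : ContinuousOn f (Set.Icc r₀ s) :=
      (isUnitaryGroup_freeGroup.continuousOn_apply (hcσ.mono hsub) continuousOn_const).inner (𝕜 := ℂ)
        (hwσ.mono hsub)
    have hfd : ∀ r ∈ Set.Ioo r₀ s, HasDerivAt f (σ • (-Complex.I * inner ℂ (mulOp (VS (σ * r))
        (freeGroup n (c (σ * r)) (φ.toLp 2 volume))) (w (σ * r)))) r := fun r hr => by
      have hr' : σ * r ∈ O := by
        simp only [hO, Set.mem_ofPred_eq, ← mul_assoc, hσ2, one_mul]
        exact hr.1
      have h1 : HasDerivAt (fun r => σ * r) σ r := by simpa using (hasDerivAt_id r).const_mul σ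
      exact (hderiv φ _ hr').scomp r h1
    have h1 := norm_sub_le_integral_of_norm_deriv_le_of_le
      (B := fun r => |C| * ‖φ.toLp 2 volume‖ * ‖w (σ * r)‖) hs.1 hfc
      (fun r hr => (hfd r hr).differentiableAt.differentiableWithinAt)
      (Eventually.of_forall fun r hr => ?_) (hint.const_mul _)
    · have h2 : f r₀ = 0 := by rw [hf]; simp only [hw0, inner_zero_right]
      rw [h2, sub_zero, intervalIntegral.integral_const_mul] at h1
      exact h1.trans_eq (by ring)
    · have hr' : |σ * r| ≤ |t| := by
        rw [habs, ← habs t, abs_of_pos (hr₀.trans hr.1)]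
        exact (hr.2.le.trans hs.2).trans (le_abs_self _)
      have hVSr : Continuous (VS (σ * r)) :=
        hVSc.comp (by fun_prop : Continuous fun x => (σ * r, x))
      rw [(hfd r hr).deriv, norm_smul, Real.norm_eq_abs, habsσ, one_mul, norm_mul, norm_neg,
        Complex.norm_I, one_mul]
      refine (norm_inner_le_norm _ _).trans ?_
      gcongr
      refine (norm_mulOp_le hVSr (fun x => (hC _ hr' x).trans (le_abs_self C)) _).trans_eq ?_
      rw [LinearIsometryEquiv.norm_map]
  have hzero : w (σ * (σ * t)) = 0 :=
    norm_eq_zero.1 (eq_zero_of_le_mul_integral ht hwσ.norm (fun _ _ => norm_nonneg _) hbound)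
  rw [← mul_assoc, hσ2, one_mul] at hzero
  have h1 : dilation n (-(l * Real.log |t| / 2)) (phase (-(m * l / (2 * t))) (u₁ t)) = u₂ t :=
    sub_eq_zero.1 hzero
  change u₁ t = phase (m * l / (2 * t)) (dilation n (l * Real.log |t| / 2) (u₂ t))
  rw [← h1, isUnitaryGroup_dilation.apply_neg_apply, isUnitaryGroup_phase.apply_neg_apply]

/-- The intertwining relation between the propagators. -/
theorem propagator_eq (hm : 0 < m) (hr₀ : 0 < r₀) (hk : 0 ≤ k) (hkm : k < m / 4) {σ : ℝ}
    (hσ : σ = 1 ∨ σ = -1) {V : ℝ → Space n → ℝ}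
    (hV : Continuous fun z : ℝ × Space n => V z.1 z.2)
    (hVb : ∀ T : ℝ, ∃ C : ℝ, ∀ t : ℝ, |t| ≤ T → ∀ x : Space n, |V t x| ≤ C)
    {U US : ℝ → ℝ → Unitary n}
    (hU : IsPropagatorOn Set.univ (ham m (coeff r₀ k kC) V) U)
    (hUS : IsPropagatorOn {τ : ℝ | r₀ ≤ σ * τ} (reducedHam m (lam m k) V) US) {t : ℝ}
    (ht : r₀ ≤ σ * t) :
    U t (σ * r₀) =
      phase (m * lam m k / (2 * t)) * expA n (lam m k * Real.log |t| / 2) * US t (σ * r₀) *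
        (phase (m * lam m k / (2 * (σ * r₀))) * expA n (lam m k * Real.log r₀ / 2))⁻¹ := by
  rw [eq_mul_inv_iff_mul_eq, expA_eq_dilation]
  exact LinearIsometryEquiv.ext fun ψ =>
    propagator_apply_eq hm hr₀ hk hkm hσ hV hVb hU hUS ht ψ

end Main

end TimeDecayingOscillator

open TimeDecayingOscillator in
theorem mainTheorem3 (n : ℕ) (m r₀ k : ℝ) (kC : ℝ → ℝ)
    (hm : 0 < m) (hr₀ : 0 < r₀) (hk : 0 ≤ k) (hkm : k < m / 4)
    (hkC : MemLp kC ⊤ (volume.restrict (Set.Icc (-r₀) r₀)))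
    (σ : ℝ) (hσ : σ = 1 ∨ σ = -1) :
    (∀ U₀ U₀S : ℝ → ℝ → Unitary n,
      IsPropagatorOn Set.univ (freeHam m (coeff r₀ k kC)) U₀ →
      IsPropagatorOn {τ : ℝ | r₀ ≤ σ * τ} (reducedFreeHam m (lam m k)) U₀S →
      ∀ t : ℝ, r₀ ≤ σ * t →
        U₀ t (σ * r₀) =
          phase (m * lam m k / (2 * t)) * expA n (lam m k * Real.log |t| / 2) *
            U₀S t (σ * r₀) *
            (phase (m * lam m k / (2 * (σ * r₀))) * expA n (lam m k * Real.log r₀ / 2))⁻¹) ∧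
    (∀ V : ℝ → Space n → ℝ, Continuous (fun z : ℝ × Space n => V z.1 z.2) →
      (∀ T : ℝ, ∃ C : ℝ, ∀ t : ℝ, |t| ≤ T → ∀ x : Space n, |V t x| ≤ C) →
      ∀ U US : ℝ → ℝ → Unitary n,
        IsPropagatorOn Set.univ (ham m (coeff r₀ k kC) V) U →
        IsPropagatorOn {τ : ℝ | r₀ ≤ σ * τ} (reducedHam m (lam m k) V) US →
        ∀ t : ℝ, r₀ ≤ σ * t →
          U t (σ * r₀) =
            phase (m * lam m k / (2 * t)) * expA n (lam m k * Real.log |t| / 2) *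
              US t (σ * r₀) *
              (phase (m * lam m k / (2 * (σ * r₀))) *
                expA n (lam m k * Real.log r₀ / 2))⁻¹) := by
  refine ⟨fun U₀ U₀S hU hUS t ht => ?_, fun V hV hVb U US hU hUS t ht =>
    propagator_eq hm hr₀ hk hkm hσ hV hVb hU hUS ht⟩
  -- The free relation is the perturbed one with zero potential.
  have h1 : ham (n := n) m (coeff r₀ k kC) (fun _ _ => 0) = freeHam m (coeff r₀ k kC) := by
    funext τ φ
    rw [ham, mulOp_zero, add_zero]
  have h2 : reducedHam (n := n) m (lam m k) (fun _ _ => 0) = reducedFreeHam m (lam m k) := by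
    funext τ φ
    rw [reducedHam, mulOp_zero, add_zero]
  exact propagator_eq (V := fun _ _ => 0) hm hr₀ hk hkm hσ continuous_const
    (fun _ => ⟨0, by simp⟩) (h1 ▸ hU) (h2 ▸ hUS) ht
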